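/- **Setting.** Let $(M,J,g,\nabla,\xi)$ be a conical (affine) special Kähler manifold: $(M,g,J)$ is a smooth finite-dimensional pseudo-Kähler manifold (a pseudo-Riemannian metric $g$ of arbitrary signature, a $g$-skew integrable almost complex structure $J$, and closed Kähler form $\omega=g(J\cdot,\cdot)$), $\nabla$ is a smooth flat torsion-free connection on $TM$ and $\xi$ is a smooth vector field such that (i) $\nabla\omega=0$; (ii) $d^\nabla J=0$, where $J$ is viewed as a $TM$-valued one-form; (iii) $\nabla\xi=D\xi=\mathrm{Id}$, where $D$ is the Levi-Civita connection of $g$; (iv) at every point $\xi,J\xi$ span a plane, on which $g$ is (positive or negative) definite. Let $\pi:N=T^*M\to M$ be the cotangent bundle. Via $\nabla$ identify $TN=T^hN\oplus T^vN=\pi^*TM\oplus\pi^*T^*M$, where $T^vN=\ker d\pi$ and $T^hN$ is the horizontal distribution of $\nabla$. The rigid c-map endows $N$ with $$g_N=\begin{pmatrix}g&0\\0&g^{-1}\end{pmatrix},\quad J_1=\begin{pmatrix}J&0\\0&J^*\end{pmatrix},\quad J_2=\begin{pmatrix}0&-\omega^{-1}\\ \omega&0\end{pmatrix},\quad J_3=J_1J_2,$$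 where $J^*\alpha=\alpha\circ J$ and $\omega:TM\to T^*M$ is $v\mapsto\omega(v,\cdot)$. Put $\omega_1=g_N(J_1\cdot,\cdot)$ and $Z=J\xi$, and let $Z_N$ be the $\nabla$-horizontal lift of $Z$ to $N$. **Proposition.** 1. $Z_N$ is the canonical extension of $Z$ to $N$: for all $\nabla$-affine local coordinates $(q^i)$ on $M$, with corresponding coordinates $(\pi^*q^i,p_i)$ on $T^*M$, one has $Z_N(\pi^*q^i)=\pi^*(Z(q^i))$ and $Z_N(p_i)=0$. 2. $Z_N$ is nowhere null: $g_N(Z_N,Z_N)\neq 0$ at every point of $N$. 3. $Z_N$ is a smooth Killing vector field, $\mathcal L_{Z_N}g_N=0$. 4. $Z_N$ is $\omega_1$-Hamiltonian: there is a smooth function $f$ on $N$ with $df=-\omega_1(Z_N,\cdot)$. 5. $g_N$ has a Levi-Civita connection $D$, and it satisfies $D_{Z_N}Z_N=J_1Z_N$. 6. $\mathcal L_{Z_N}J_2=-J_3$. -/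

import Mathlib

open Bundle
open scoped Manifold ContDiff

noncomputable section

/-! ### Tensor fields, connections and pseudo-Kähler structures on a manifold -/

section General

variable {E : Type*} [NormedAddCommGroup E] [NormedSpace ℝ E]
  {H : Type*} [TopologicalSpace H] {I : ModelWithCorners ℝ E H}
  {M : Type*} [TopologicalSpace M] [ChartedSpace H M]

/-- Covariant two-tensor fields (no regularity imposed). -/
abbrev TwoTensor (I : ModelWithCorners ℝ E H) (M : Type*) [TopologicalSpace M]
    [ChartedSpace H M] :=
  Π x : M, TangentSpace I x →L[ℝ] TangentSpace I x →L[ℝ] ℝ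

/-- Fields of endomorphisms of the tangent spaces (no regularity imposed). -/
abbrev EndField (I : ModelWithCorners ℝ E H) (M : Type*) [TopologicalSpace M]
    [ChartedSpace H M] :=
  Π x : M, TangentSpace I x →L[ℝ] TangentSpace I x

/-- Vector fields (no regularity imposed). -/
abbrev VField (I : ModelWithCorners ℝ E H) (M : Type*) [TopologicalSpace M]
    [ChartedSpace H M] :=
  Π x : M, TangentSpace I x

instance tangentSpace_finiteDimensional [FiniteDimensional ℝ E]
    (I : ModelWithCorners ℝ E H) (x : M) : FiniteDimensional ℝ (TangentSpace I x) :=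
  inferInstanceAs (FiniteDimensional ℝ E)

instance tangentSpace_t2Space (I : ModelWithCorners ℝ E H) (x : M) :
    T2Space (TangentSpace I x) :=
  inferInstanceAs (T2Space E)

/-- The two-form `ω = g(J·, ·)`. As a map from tangent vectors to covectors,
`fundamentalForm g J x v` is `ω(v, ·)`. -/
def fundamentalForm (g : TwoTensor I M) (J : EndField I M) : TwoTensor I M :=
  fun x ↦ (g x) ∘L (J x)

/-- The inverse `B⁻¹ : T*M → TM` of the map `v ↦ B(v, ·)` of a nondegenerate two-tensor. -/
def inverseTensor (B : TwoTensor I M) (x : M) :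
    (TangentSpace I x →L[ℝ] ℝ) →L[ℝ] TangentSpace I x :=
  (B x).inverse

/-- The inverse is a genuine inverse at every point where `B` is nondegenerate. -/
theorem inverseTensor_spec [FiniteDimensional ℝ E] (B : TwoTensor I M) (x : M)
    (hB : ∀ v, (∀ w, B x v w = 0) → v = 0) :
    (∀ v, inverseTensor B x (B x v) = v) ∧ ∀ a, B x (inverseTensor B x a) = a := by
  have hinj : Function.Injective (B x : TangentSpace I x →ₗ[ℝ] TangentSpace I x →L[ℝ] ℝ) := by
    rw [← LinearMap.ker_eq_bot, LinearMap.ker_eq_bot']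
    exact fun v hv ↦ hB v fun w ↦ congr($hv w)
  have hrank : Module.finrank ℝ (TangentSpace I x) =
      Module.finrank ℝ (TangentSpace I x →L[ℝ] ℝ) := by
    rw [← LinearEquiv.finrank_eq (LinearMap.toContinuousLinearMap
      (𝕜 := ℝ) (E := TangentSpace I x) (F' := ℝ)), Subspace.dual_finrank_eq]
  let e := (LinearEquiv.ofInjectiveOfFinrankEq _ hinj hrank).toContinuousLinearEquiv
  have he : (B x) = (e : TangentSpace I x →L[ℝ] TangentSpace I x →L[ℝ] ℝ) := by
    ext v w; rfl
  rw [inverseTensor, he, ContinuousLinearMap.inverse_equiv]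
  exact ⟨fun v ↦ e.symm_apply_apply v, fun a ↦ e.apply_symm_apply a⟩

/-- A two-form is closed: the invariant formula for `dω(X, Y, W)` vanishes. -/
def IsClosedTwoForm [IsManifold I ∞ M] (Ω : TwoTensor I M) : Prop :=
  ∀ (x : M) (X Y W : VField I M),
    MDiffAt (T% X) x → MDiffAt (T% Y) x → MDiffAt (T% W) x →
      mvfderiv I (fun y ↦ Ω y (Y y) (W y)) x (X x)
        - mvfderiv I (fun y ↦ Ω y (X y) (W y)) x (Y x)
        + mvfderiv I (fun y ↦ Ω y (X y) (Y y)) x (W x)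
        - Ω x (VectorField.mlieBracket I X Y x) (W x)
        + Ω x (VectorField.mlieBracket I X W x) (Y x)
        - Ω x (VectorField.mlieBracket I Y W x) (X x) = 0

/-- An almost complex structure is integrable: its Nijenhuis tensor vanishes. -/
def IsIntegrableACS [IsManifold I ∞ M] (J : EndField I M) : Prop :=
  ∀ (x : M) (X Y : VField I M), MDiffAt (T% X) x → MDiffAt (T% Y) x →
    VectorField.mlieBracket I (fun y ↦ J y (X y)) (fun y ↦ J y (Y y)) x
      - J x (VectorField.mlieBracket I (fun y ↦ J y (X y)) Y x)
      - J x (VectorField.mlieBracket I X (fun y ↦ J y (Y y)) x)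
      - VectorField.mlieBracket I X Y x = 0

/-- A smooth pseudo-Riemannian metric of arbitrary signature. -/
structure IsPseudoRiemannian [IsManifold I ∞ M] (g : TwoTensor I M) : Prop where
  smooth : ContMDiff I (I.prod 𝓘(ℝ, E →L[ℝ] E →L[ℝ] ℝ)) ∞
    (fun x ↦ TotalSpace.mk' (E →L[ℝ] E →L[ℝ] ℝ) x (g x))
  symm : ∀ (x : M) (v w : TangentSpace I x), g x v w = g x w v
  nondegenerate : ∀ (x : M) (v : TangentSpace I x), (∀ w, g x v w = 0) → v = 0

/-- A pseudo-Kähler structure `(g, J)` with Kähler form `g(J·, ·)`. -/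
structure IsPseudoKahler [IsManifold I ∞ M] (g : TwoTensor I M) (J : EndField I M) : Prop where
  metric : IsPseudoRiemannian g
  smooth : ContMDiff I (I.prod 𝓘(ℝ, E →L[ℝ] E)) ∞
    (fun x ↦ TotalSpace.mk' (E →L[ℝ] E) x (J x))
  sq : ∀ (x : M) (v : TangentSpace I x), J x (J x v) = -v
  skew : ∀ (x : M) (v w : TangentSpace I x), g x (J x v) w = -g x v (J x w)
  closed : IsClosedTwoForm (fundamentalForm g J)
  integrable : IsIntegrableACS J

/-- Affine connections, i.e. covariant derivatives on the tangent bundle;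
`D Y x v` is `D_v Y` at the point `x`. -/
abbrev AffineConnection (I : ModelWithCorners ℝ E H) (M : Type*) [TopologicalSpace M]
    [ChartedSpace H M] [IsManifold I ∞ M] :=
  CovariantDerivative I E (TangentSpace I : M → Type _)

/-- The torsion tensor vanishes. -/
def IsTorsionFree [FiniteDimensional ℝ E] [IsManifold I ∞ M] (D : AffineConnection I M) : Prop :=
  haveI : CompleteSpace E := FiniteDimensional.complete ℝ E
  D.torsion = 0

/-- The two-tensor `B` is parallel: `v(B(Y, W)) = B(D_v Y, W) + B(Y, D_v W)`. -/
def IsParallelTwoTensor [IsManifold I ∞ M] (D : AffineConnection I M) (B : TwoTensor I M) :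
    Prop :=
  ∀ (x : M) (Y W : VField I M), MDiffAt (T% Y) x → MDiffAt (T% W) x →
    ∀ v : TangentSpace I x,
      mvfderiv I (fun y ↦ B y (Y y) (W y)) x v =
        B x (D Y x v) (W x) + B x (Y x) (D W x v)

/-- `D` is the Levi-Civita connection of `g`: torsion-free and metric. -/
def IsLeviCivita [FiniteDimensional ℝ E] [IsManifold I ∞ M] (g : TwoTensor I M)
    (D : AffineConnection I M) : Prop :=
  IsTorsionFree D ∧ IsParallelTwoTensor D g

/-- The curvature `R(X, Y) W = D_X D_Y W - D_Y D_X W - D_[X,Y] W` vanishes. -/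
def IsFlatConnection [IsManifold I ∞ M] (D : AffineConnection I M) : Prop :=
  ∀ X Y W : VField I M, ContMDiff I I.tangent ∞ (T% X) → ContMDiff I I.tangent ∞ (T% Y) →
    ContMDiff I I.tangent ∞ (T% W) → ∀ x : M,
      D (fun y ↦ D W y (Y y)) x (X x) - D (fun y ↦ D W y (X y)) x (Y x)
        - D W x (VectorField.mlieBracket I X Y x) = 0

/-- `d^D J = 0`, where `J` is regarded as a one-form with values in the tangent bundle. -/
def IsClosedEndField [IsManifold I ∞ M] (D : AffineConnection I M) (J : EndField I M) : Prop :=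
  ∀ (x : M) (X Y : VField I M), MDiffAt (T% X) x → MDiffAt (T% Y) x →
    D (fun y ↦ J y (Y y)) x (X x) - D (fun y ↦ J y (X y)) x (Y x)
      - J x (VectorField.mlieBracket I X Y x) = 0

/-- A conical (affine) special Kähler manifold `(M, J, g, ∇, ξ)`. -/
structure IsConicalSpecialKahler [FiniteDimensional ℝ E] [IsManifold I ∞ M]
    (g : TwoTensor I M) (J : EndField I M) (nabla : AffineConnection I M) (ξ : VField I M) :
    Prop where
  kahler : IsPseudoKahler g J
  smooth_nabla : CovariantDerivative.ContMDiffCovariantDerivative nabla ∞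
  torsionFree : IsTorsionFree nabla
  flat : IsFlatConnection nabla
  smooth_xi : ContMDiff I I.tangent ∞ (T% ξ)
  parallel_form : IsParallelTwoTensor nabla (fundamentalForm g J)
  closed_J : IsClosedEndField nabla J
  nabla_xi : ∀ (x : M) (v : TangentSpace I x), nabla ξ x v = v
  leviCivita_xi : ∃ D : AffineConnection I M, IsLeviCivita g D ∧
    ∀ (x : M) (v : TangentSpace I x), D ξ x v = v
  plane : ∀ x : M, LinearIndependent ℝ ![ξ x, J x (ξ x)]
  definite : ∀ x : M,
    (∀ v ∈ Submodule.span ℝ {ξ x, J x (ξ x)}, v ≠ 0 → 0 < g x v v) ∨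
    (∀ v ∈ Submodule.span ℝ {ξ x, J x (ξ x)}, v ≠ 0 → g x v v < 0)

/-- The smooth vector field `Z` satisfies `(L_Z g)(X, Y) = Z(g(X, Y)) - g([Z, X], Y) - g(X, [Z, Y])
= 0` for all `X`, `Y`. -/
def IsKilling [IsManifold I ∞ M] (g : TwoTensor I M) (Z : VField I M) : Prop :=
  ContMDiff I I.tangent ∞ (T% Z) ∧
  ∀ (x : M) (X Y : VField I M), MDiffAt (T% X) x → MDiffAt (T% Y) x →
    mvfderiv I (fun y ↦ g y (X y) (Y y)) x (Z x)
      - g x (VectorField.mlieBracket I Z X x) (Y x)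
      - g x (X x) (VectorField.mlieBracket I Z Y x) = 0

/-- `Z` is `Ω`-Hamiltonian: `df = -Ω(Z, ·)` for some smooth function `f`. -/
def IsHamiltonian (Ω : TwoTensor I M) (Z : VField I M) : Prop :=
  ∃ f : M → ℝ, ContMDiff I 𝓘(ℝ, ℝ) ∞ f ∧
    ∀ (x : M) (v : TangentSpace I x), mvfderiv I f x v = -Ω x (Z x) v

/-- The Lie derivative of an endomorphism field, `(L_Z A) X = [Z, A X] - A [Z, X]`. -/
def lieDerivEnd (Z : VField I M) (A : EndField I M) (X : VField I M) : VField I M :=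
  fun x ↦ VectorField.mlieBracket I Z (fun y ↦ A y (X y)) x
    - A x (VectorField.mlieBracket I Z X x)

end General

/-! ### The cotangent bundle and its splitting defined by an affine connection -/

/-- The total space `N = T*M`. -/
abbrev CotangentBundle (E : Type*) [NormedAddCommGroup E] [NormedSpace ℝ E]
    (M : Type*) [TopologicalSpace M] [ChartedSpace E M] :=
  TotalSpace (E →L[ℝ] ℝ) (fun x : M ↦ TangentSpace 𝓘(ℝ, E) x →L[ℝ] ℝ)

/-- The model with corners of `T*M`. -/
abbrev cotangentModel (E : Type*) [NormedAddCommGroup E] [NormedSpace ℝ E] :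
    ModelWithCorners ℝ (E × (E →L[ℝ] ℝ)) (ModelProd E (E →L[ℝ] ℝ)) :=
  𝓘(ℝ, E).prod 𝓘(ℝ, E →L[ℝ] ℝ)

section Cotangent

variable {E : Type*} [NormedAddCommGroup E] [NormedSpace ℝ E]
  {M : Type*} [TopologicalSpace M] [ChartedSpace E M]

/-- The fibrewise linear function `α ↦ α(X)` on `T*M` defined by a vector field `X` on `M`. -/
def momentum (X : VField 𝓘(ℝ, E) M) (p : CotangentBundle E M) : ℝ :=
  p.2 (X p.proj)

variable [IsManifold 𝓘(ℝ, E) ∞ M]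

theorem mdifferentiableAt_cotangentProj (p : CotangentBundle E M) :
    MDifferentiableAt (cotangentModel E) 𝓘(ℝ, E)
      (TotalSpace.proj : CotangentBundle E M → M) p :=
  (contMDiffAt_proj (n := 1) _).mdifferentiableAt one_ne_zero

theorem mdifferentiableAt_momentum {X : VField 𝓘(ℝ, E) M} {p : CotangentBundle E M}
    (hX : MDiffAt (T% X) p.proj) :
    MDifferentiableAt (cotangentModel E) 𝓘(ℝ, ℝ) (momentum X) p := by
  have h1 : MDifferentiableAt (cotangentModel E) (𝓘(ℝ, E).prod 𝓘(ℝ, E →L[ℝ] ℝ))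
      (fun q : CotangentBundle E M ↦ TotalSpace.mk' (E →L[ℝ] ℝ)
        (E := fun x : M ↦ TangentSpace 𝓘(ℝ, E) x →L[ℝ] Bundle.Trivial M ℝ x) q.proj q.2) p :=
    mdifferentiableAt_id
  have h2 : MDifferentiableAt (cotangentModel E) (𝓘(ℝ, E).prod 𝓘(ℝ, E))
      (fun q : CotangentBundle E M ↦ TotalSpace.mk' E
        (E := fun x : M ↦ TangentSpace 𝓘(ℝ, E) x) q.proj (X q.proj)) p :=
    MDifferentiableAt.comp p hX (mdifferentiableAt_cotangentProj p)
  have h3 := MDifferentiableAt.clm_bundle_apply (F₁ := E) (F₂ := ℝ)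
    (E₁ := fun x : M ↦ TangentSpace 𝓘(ℝ, E) x) (E₂ := Bundle.Trivial M ℝ)
    (b := fun q : CotangentBundle E M ↦ q.proj) (ϕ := fun q : CotangentBundle E M ↦ q.2)
    (v := fun q : CotangentBundle E M ↦ X q.proj) h1 h2
  rw [mdifferentiableAt_totalSpace] at h3
  exact h3.2

/-- The differential `dπ` of the projection `π : T*M → M`. -/
def cotangentProj (p : CotangentBundle E M) :
    TangentSpace (cotangentModel E) p →L[ℝ] TangentSpace 𝓘(ℝ, E) p.proj :=
  mfderiv (cotangentModel E) 𝓘(ℝ, E) (TotalSpace.proj : CotangentBundle E M → M) p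

/-- For a vector field `X` on `M` and `α ∈ T*M` over `x`, the linear form
`u ↦ u(momentum X) - α(∇_{dπ u} X)` on the tangent space of `T*M` at `α`. -/
def connectorAux (nabla : AffineConnection 𝓘(ℝ, E) M) (p : CotangentBundle E M)
    (X : VField 𝓘(ℝ, E) M) : TangentSpace (cotangentModel E) p →L[ℝ] ℝ :=
  mvfderiv (cotangentModel E) (momentum X) p - (p.2 ∘L nabla X p.proj) ∘L cotangentProj p

theorem connectorAux_tensorial (nabla : AffineConnection 𝓘(ℝ, E) M) (p : CotangentBundle E M) :
    TensorialAt 𝓘(ℝ, E) E (connectorAux nabla p) p.proj where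
  smul {f X} hf hX := by
    have hproj := mdifferentiableAt_cotangentProj p
    have e : momentum (f • X) =
        (fun q : CotangentBundle E M ↦ (f ∘ TotalSpace.proj) q * momentum X q) := by
      funext q; simp [momentum]
    ext u
    have hfp : MDifferentiableAt (cotangentModel E) 𝓘(ℝ, ℝ)
        (f ∘ (TotalSpace.proj : CotangentBundle E M → M)) p :=
      MDifferentiableAt.comp p hf hproj
    have hc : mvfderiv (cotangentModel E) (f ∘ (TotalSpace.proj : CotangentBundle E M → M)) p u =
        mvfderiv 𝓘(ℝ, E) f p.proj (cotangentProj p u) := by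
      simp only [mvfderiv, cotangentProj]
      rw [mfderiv_comp p hf hproj]
      rfl
    have hm := mvfderiv_fun_mul hfp (mdifferentiableAt_momentum hX)
    simp only [connectorAux, e, nabla.isCovariantDerivativeOn.leibniz hX hf, hm]
    simp [hc, momentum]
    ring
  add {X Y} hX hY := by
    have e : momentum (X + Y) =
        (fun q : CotangentBundle E M ↦ momentum X q + momentum Y q) := by
      funext q; simp [momentum]
    ext u
    have hm := mvfderiv_fun_add (mdifferentiableAt_momentum (p := p) hX)
      (mdifferentiableAt_momentum hY)
    simp only [connectorAux, e, nabla.isCovariantDerivativeOn.add hX hY, hm]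
    simp
    ring

variable [FiniteDimensional ℝ E]

/-- The connector `K` of `∇`, the projection of `T_α(T*M)` onto the vertical tangent space
`T*_x M` along the horizontal one: `K(u)(X_x) = u(momentum X) - α(∇_{dπ u} X)` for every vector
field `X`. On `u = dσ(v)`, for a one-form `σ`, it is `∇_v σ`; on vertical vectors it is the
canonical identification. -/
def connector (nabla : AffineConnection 𝓘(ℝ, E) M) (p : CotangentBundle E M) :
    TangentSpace (cotangentModel E) p →L[ℝ] (TangentSpace 𝓘(ℝ, E) p.proj →L[ℝ] ℝ) :=
  LinearMap.toContinuousLinearMap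
  { toFun u := LinearMap.toContinuousLinearMap
      { toFun w := TensorialAt.mkHom (connectorAux nabla p) p.proj
          (connectorAux_tensorial nabla p) w u
        map_add' v w := by rw [map_add]; rfl
        map_smul' c v := by rw [map_smul]; rfl }
    map_add' u v := by
      ext w
      exact map_add (TensorialAt.mkHom (connectorAux nabla p) p.proj
        (connectorAux_tensorial nabla p) w) u v
    map_smul' c u := by
      ext w
      exact map_smul (TensorialAt.mkHom (connectorAux nabla p) p.proj
        (connectorAux_tensorial nabla p) w) c u }

theorem connector_apply (nabla : AffineConnection 𝓘(ℝ, E) M) (p : CotangentBundle E M)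
    (u : TangentSpace (cotangentModel E) p) {X : VField 𝓘(ℝ, E) M}
    (hX : MDiffAt (T% X) p.proj) :
    connector nabla p u (X p.proj) =
      mvfderiv (cotangentModel E) (momentum X) p u
        - p.2 (nabla X p.proj (cotangentProj p u)) := by
  have := TensorialAt.mkHom_apply (connectorAux_tensorial nabla p) hX
  exact congr($this u)

set_option linter.unusedSectionVars false in
theorem mfderiv_clm_extChartAt (p : CotangentBundle E M) {G : Type*} [NormedAddCommGroup G]
    [NormedSpace ℝ G] (L : E × (E →L[ℝ] ℝ) →L[ℝ] G) (f : CotangentBundle E M → G)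
    (hf : f =ᶠ[nhds p] L ∘ extChartAt (cotangentModel E) p) (u : TangentSpace (cotangentModel E) p) :
    mfderiv (cotangentModel E) 𝓘(ℝ, G) f p u = L u := by
  have hd : HasMFDerivAt (cotangentModel E) 𝓘(ℝ, E × (E →L[ℝ] ℝ))
      (extChartAt (cotangentModel E) p) p (ContinuousLinearMap.id ℝ _) := by
    rw [← mfderiv_extChartAt_self]
    exact (mdifferentiableAt_extChartAt (mem_chart_source _ p)).hasMFDerivAt
  rw [hf.mfderiv_eq]
  exact congr($((L.hasMFDerivAt.comp p hd).mfderiv) u)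

theorem eq_zero_of_proj_connector (nabla : AffineConnection 𝓘(ℝ, E) M)
    (p : CotangentBundle E M) (u : TangentSpace (cotangentModel E) p)
    (h1 : cotangentProj p u = 0) (h2 : connector nabla p u = 0) : u = 0 := by
  have hfst : (ContinuousLinearMap.fst ℝ E (E →L[ℝ] ℝ)) u = 0 := by
    refine (mfderiv_clm_extChartAt p (ContinuousLinearMap.fst ℝ E (E →L[ℝ] ℝ))
      (extChartAt 𝓘(ℝ, E) p.proj ∘ TotalSpace.proj)
      (by refine Filter.Eventually.of_forall fun q ↦ ?_; rw [FiberBundle.extChartAt]; rfl) u).symm.trans ?_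
    rw [mfderiv_comp p (mdifferentiableAt_extChartAt (mem_chart_source _ _))
      (mdifferentiableAt_cotangentProj p)]
    have hz : mfderiv (cotangentModel E) 𝓘(ℝ, E)
      (TotalSpace.proj : CotangentBundle E M → M) p u = 0 := h1
    rw [ContinuousLinearMap.comp_apply, hz, map_zero]
    rfl
  have hsnd : ∀ e : E, ((ContinuousLinearMap.apply ℝ ℝ e) ∘L
      (ContinuousLinearMap.snd ℝ E (E →L[ℝ] ℝ))) u = 0 := by
    intro e
    set w : TangentSpace 𝓘(ℝ, E) p.proj :=
      (trivializationAt E (TangentSpace 𝓘(ℝ, E)) p.proj).symm p.proj e with hw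
    have hX : MDiffAt (T% (FiberBundle.extend E w)) p.proj :=
      FiberBundle.mdifferentiableAt_extend 𝓘(ℝ, E) E w
    have h4 := connector_apply nabla p u hX
    have h6 : p.2 (nabla (FiberBundle.extend E w) p.proj (cotangentProj p u)) = 0 := by
      rw [h1, map_zero, map_zero]
    have h7 : connector nabla p u (FiberBundle.extend E w p.proj) = 0 := by
      rw [h2]; rfl
    have h5 : mvfderiv (cotangentModel E) (momentum (FiberBundle.extend E w)) p u = 0 := by
      linarith
    refine (mfderiv_clm_extChartAt p ((ContinuousLinearMap.apply ℝ ℝ e) ∘L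
      (ContinuousLinearMap.snd ℝ E (E →L[ℝ] ℝ))) (momentum (FiberBundle.extend E w))
      ?_ u).symm.trans h5
    have hU : ∀ᶠ q : CotangentBundle E M in nhds p,
        q.proj ∈ (trivializationAt E (TangentSpace 𝓘(ℝ, E)) p.proj).baseSet :=
      (FiberBundle.continuous_proj _ _).continuousAt.eventually
        ((trivializationAt E (TangentSpace 𝓘(ℝ, E)) p.proj).open_baseSet.mem_nhds
          (FiberBundle.mem_baseSet_trivializationAt' p.proj))
    filter_upwards [hU] with q hq
    rw [FiberBundle.extChartAt]
    have hwe : (trivializationAt E (TangentSpace 𝓘(ℝ, E)) p.proj ⟨p.proj, w⟩).2 = e := by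
      rw [hw, Trivialization.apply_mk_symm _ (FiberBundle.mem_baseSet_trivializationAt' p.proj)]
    simp only [momentum, FiberBundle.extend, hwe]
    simp [hom_trivializationAt_apply, ContinuousLinearMap.inCoordinates]
    exact congrArg q.2 (Trivialization.symmL_apply (R := ℝ) _ hq e).symm
  exact Prod.ext hfst (ContinuousLinearMap.ext hsnd)

/-- The identification `T_α N = T^h N ⊕ T^v N = T_x M ⊕ T*_x M` defined by `∇`, for `N = T*M`
and `α ∈ N` over `x`. The horizontal space is the kernel of the connector. -/
def splitting (nabla : AffineConnection 𝓘(ℝ, E) M) (p : CotangentBundle E M) :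
    TangentSpace (cotangentModel E) p ≃L[ℝ]
      TangentSpace 𝓘(ℝ, E) p.proj × (TangentSpace 𝓘(ℝ, E) p.proj →L[ℝ] ℝ) :=
  (LinearEquiv.ofInjectiveOfFinrankEq
    ((cotangentProj p).toLinearMap.prod (connector nabla p).toLinearMap)
    (by
      rw [← LinearMap.ker_eq_bot, LinearMap.ker_eq_bot']
      intro u hu
      exact eq_zero_of_proj_connector nabla p u congr(($hu).1) congr(($hu).2))
    rfl).toContinuousLinearEquiv

theorem splitting_apply (nabla : AffineConnection 𝓘(ℝ, E) M) (p : CotangentBundle E M)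
    (u : TangentSpace (cotangentModel E) p) :
    splitting nabla p u = (cotangentProj p u, connector nabla p u) := rfl

/-! ### The rigid c-map -/

/-- `g_N = g ⊕ g⁻¹`. -/
def cmapMetric (g : TwoTensor 𝓘(ℝ, E) M) (nabla : AffineConnection 𝓘(ℝ, E) M) :
    TwoTensor (cotangentModel E) (CotangentBundle E M) :=
  fun p ↦ LinearMap.toContinuousBilinearMap
    (LinearMap.mk₂ ℝ
      (fun u v : TangentSpace (cotangentModel E) p ↦
        g p.proj (splitting nabla p u).1 (splitting nabla p v).1
          + (splitting nabla p v).2 (inverseTensor g p.proj (splitting nabla p u).2))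
      (fun u u' v ↦ by simp; ring) (fun c u v ↦ by simp; ring)
      (fun u v v' ↦ by simp; ring) (fun c u v ↦ by simp; ring))

/-- `J₁ = J ⊕ J*`, where `J* α = α ∘ J`. -/
def cmapJ₁ (J : EndField 𝓘(ℝ, E) M) (nabla : AffineConnection 𝓘(ℝ, E) M) :
    EndField (cotangentModel E) (CotangentBundle E M) :=
  fun p ↦ (splitting nabla p).symm ∘L
    ((J p.proj).prodMap (ContinuousLinearMap.precomp ℝ (J p.proj) :
      (TangentSpace 𝓘(ℝ, E) p.proj →L[ℝ] ℝ) →L[ℝ] (TangentSpace 𝓘(ℝ, E) p.proj →L[ℝ] ℝ))) ∘L (splitting nabla p)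

/-- `J₂(v, α) = (-ω⁻¹ α, ω v)`. -/
def cmapJ₂ (g : TwoTensor 𝓘(ℝ, E) M) (J : EndField 𝓘(ℝ, E) M)
    (nabla : AffineConnection 𝓘(ℝ, E) M) :
    EndField (cotangentModel E) (CotangentBundle E M) :=
  fun p ↦ (splitting nabla p).symm ∘L
    ((-(inverseTensor (fundamentalForm g J) p.proj ∘L
        ContinuousLinearMap.snd ℝ (TangentSpace 𝓘(ℝ, E) p.proj)
          (TangentSpace 𝓘(ℝ, E) p.proj →L[ℝ] ℝ))).prod
      (fundamentalForm g J p.proj ∘L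
        ContinuousLinearMap.fst ℝ (TangentSpace 𝓘(ℝ, E) p.proj)
          (TangentSpace 𝓘(ℝ, E) p.proj →L[ℝ] ℝ))) ∘L (splitting nabla p)

/-- `J₃ = J₁ J₂`. -/
def cmapJ₃ (g : TwoTensor 𝓘(ℝ, E) M) (J : EndField 𝓘(ℝ, E) M)
    (nabla : AffineConnection 𝓘(ℝ, E) M) :
    EndField (cotangentModel E) (CotangentBundle E M) :=
  fun p ↦ (cmapJ₁ J nabla p) ∘L (cmapJ₂ g J nabla p)

/-- The extension of a vector field `Z` on `M` to `N = T*M`: its horizontal lift `(Z, 0)`. -/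
def cotangentLift (nabla : AffineConnection 𝓘(ℝ, E) M) (Z : VField 𝓘(ℝ, E) M) :
    VField (cotangentModel E) (CotangentBundle E M) :=
  fun p ↦ (splitting nabla p).symm (Z p.proj, 0)

/-- The coordinate vector field on the domain of the chart `φ` that corresponds to the constant
vector `e`. -/
def coordField (φ : OpenPartialHomeomorph M E) (e : E) : VField 𝓘(ℝ, E) M :=
  VectorField.mpullback 𝓘(ℝ, E) 𝓘(ℝ, E) φ (fun _ ↦ e)

/-- A `∇`-affine chart: a smooth chart with parallel coordinate vector fields. -/
def IsAffineChart (nabla : AffineConnection 𝓘(ℝ, E) M) (φ : OpenPartialHomeomorph M E) : Prop :=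
  φ ∈ IsManifold.maximalAtlas 𝓘(ℝ, E) ∞ M ∧
    ∀ (e : E), ∀ x ∈ φ.source, nabla (coordField φ e) x = 0

/-- In all `∇`-affine coordinates `(q^i)` on `M`, with corresponding coordinates
`(π*q^i, p_i)` on `T*M`, one has `Z_N(π*q^i) = π*(Z(q^i))` and `Z_N(p_i) = 0`.
Here `q^i = ℓ ∘ φ` for linear forms `ℓ`, and `p_i(α) = α(∂_i)`. -/
def IsAffineCoordinateLift (nabla : AffineConnection 𝓘(ℝ, E) M) (Z : VField 𝓘(ℝ, E) M)
    (ZN : VField (cotangentModel E) (CotangentBundle E M)) : Prop :=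
  ∀ φ : OpenPartialHomeomorph M E, IsAffineChart nabla φ →
    ∀ p : CotangentBundle E M, p.proj ∈ φ.source →
      (∀ l : E →L[ℝ] ℝ,
        mvfderiv (cotangentModel E) (fun q : CotangentBundle E M ↦ l (φ q.proj)) p (ZN p) =
          mvfderiv 𝓘(ℝ, E) (fun x ↦ l (φ x)) p.proj (Z p.proj)) ∧
      ∀ e : E, mvfderiv (cotangentModel E) (momentum (coordField φ e)) p (ZN p) = 0

end Cotangent

end

/-!
The cotangent bundle `N = T*M` is studied through pairs `(X, Y)` of vector fields on `M`: the pair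
stands for the vector field on `N` with horizontal part `X` and vertical part the one-form
`ω(Y, ·)` (`cotangentLiftPair`). In these terms the structure of the rigid c-map has constant
coefficients: `g_N = g ⊕ g` (`cmapMetric_splitting_symm`) and `J₂(X, Y) = (-Y, X)`
(`cmapJ₂_splitting_symm`). Because `∇` is flat and `ω` is parallel, the bracket with the horizontal
lift `Z_N` is `[Z_N, (X, Y)] = ([Z, X], ∇_Z Y)` (`mlieBracket_cotangentLiftPair`).

On `M`, the tensors `g` and `ω` are both homogeneous of degree two under `ξ`, by the two conditions
`Dξ = Id` and `∇ξ = Id`. Hence `L_ξ J = 0`; then `d^∇ J = 0` gives `∇Z = J` for `Z = Jξ`, and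
integrability gives `L_Z J = 0`. So `∇_Z = L_Z + J` on vector fields, and since `ω` is parallel,
both `L_Z g = 0` and `∇_Z g = 0` (`mvfderiv_metric_J_xi`, `mvfderiv_metric_nabla_J_xi`). These are
the horizontal and the vertical part of the Killing equation for `Z_N`, and the difference
`∇_Z - L_Z = J` is what makes `L_{Z_N} J₂ = -J₃`.

The Hamiltonian of `Z_N` and the acceleration `D_{Z_N} Z_N` both come from the function `g(ξ, ξ)`,
whose gradient is `2ξ`: one has `g_N(Z_N, Z_N) = π*(g(Z, Z)) = π*(g(ξ, ξ))`, and for a Killing field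
`D_Z Z` is minus half the gradient of its square length (`IsKilling.levi_civita_self`).

Both the Killing equation and the formula for `L_{Z_N} J₂` are tensorial, so they need only be
checked on lifts of pairs of global smooth fields. Tensoriality requires that `g_N` and `J₂`
preserve differentiability; this is read off from a local frame of lifts
(`exists_cotangent_frame`). The Levi-Civita connection of `g_N` is constructed from the Koszul
formula (`exists_isLeviCivita`).
-/

noncomputable section

open Filter Topology VectorField

/-! ### Global extensions, brackets as derivations, and local frames -/

section General

variable {E : Type*} [NormedAddCommGroup E] [NormedSpace ℝ E] [FiniteDimensional ℝ E]
  {H : Type*} [TopologicalSpace H] {I : ModelWithCorners ℝ E H}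
  {M : Type*} [TopologicalSpace M] [ChartedSpace H M] [IsManifold I ∞ M]

/-- A tangent vector extends to a global smooth vector field which near its base point agrees with
Mathlib's extension by constant coefficients in the preferred trivialization. -/
theorem exists_contMDiff_eventuallyEq_extend [T2Space M] {x : M} (v : TangentSpace I x) :
    ∃ X : VField I M, ContMDiff I I.tangent ∞ (T% X) ∧
      ∀ᶠ y in 𝓝 x, X y = FiberBundle.extend E v y := by
  obtain ⟨s, hs, hsm⟩ := FiberBundle.exists_contMDiffOn_extend (k := ∞) I E v
  obtain ⟨u, hus, hu, hxu⟩ := mem_nhds_iff.mp hs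
  obtain ⟨f, -, hf⟩ := (SmoothBumpFunction.nhds_basis_tsupport (I := I) x).mem_iff.mp
    (hu.mem_nhds hxu)
  refine ⟨(f : M → ℝ) • FiberBundle.extend E v,
    ContMDiffOn.smul_section_of_tsupport f.contMDiff.contMDiffOn hu hf (hsm.mono hus), ?_⟩
  filter_upwards [f.eventuallyEq_one] with y hy
  simp [hy]

theorem exists_contMDiff_eq [T2Space M] {x : M} (v : TangentSpace I x) :
    ∃ X : VField I M, ContMDiff I I.tangent ∞ (T% X) ∧ X x = v := by
  obtain ⟨X, hX, he⟩ := exists_contMDiff_eventuallyEq_extend v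
  exact ⟨X, hX, by simpa using he.self_of_nhds⟩

/-- The bracket acts on functions as the commutator of derivations. The bracket of Mathlib is
defined in charts; here the formula is extracted from its algebraic properties, by applying the
Jacobi identity to `X`, `Y` and `f • W` and comparing with the Jacobi identity for `X`, `Y` and
`W`, where `W` is any vector field that does not vanish at `x`. -/
theorem mvfderiv_mlieBracket {f : M → ℝ} {X Y : VField I M} {x : M}
    (hf : ContMDiffAt I 𝓘(ℝ, ℝ) ∞ f x)
    (hX : ContMDiffAt I I.tangent ∞ (T% X) x) (hY : ContMDiffAt I I.tangent ∞ (T% Y) x)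
    (hXf : MDiffAt (fun y ↦ mvfderiv I f y (X y)) x)
    (hYf : MDiffAt (fun y ↦ mvfderiv I f y (Y y)) x) :
    mvfderiv I f x (mlieBracket I X Y x) =
      mvfderiv I (fun y ↦ mvfderiv I f y (Y y)) x (X x) -
        mvfderiv I (fun y ↦ mvfderiv I f y (X y)) x (Y x) := by
  have : CompleteSpace E := FiniteDimensional.complete ℝ E
  -- The field `W` below must not vanish at `x`, so the zero-dimensional case is separate.
  rcases subsingleton_or_nontrivial E with hE | hE
  · have : Subsingleton (TangentSpace I x) := hE
    rw [Subsingleton.elim (mlieBracket I X Y x) 0, Subsingleton.elim (X x) 0,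
      Subsingleton.elim (Y x) 0]
    simp
  have m2 : minSmoothness ℝ 2 ≤ ∞ := by
    simpa using WithTop.coe_le_coe.mpr (le_top : (2 : ℕ∞) ≤ ⊤)
  have m3 : minSmoothness ℝ 3 ≤ ∞ := by
    simpa using WithTop.coe_le_coe.mpr (le_top : (3 : ℕ∞) ≤ ⊤)
  have : IsManifold I (minSmoothness ℝ 2) M := .of_le m2
  have : IsManifold I (minSmoothness ℝ 3) M := .of_le m3
  have : IsManifold I (((2 : ℕ∞) : ℕ∞ω) + 1) M := .of_le (n := ∞)
    (WithTop.coe_le_coe.mpr (le_top : (2 : ℕ∞) + 1 ≤ ⊤))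
  obtain ⟨w, hw⟩ := exists_ne (0 : E)
  let w' : TangentSpace I x := w
  set W : VField I M := FiberBundle.extend E w' with hWdef
  have hWx : W x = w' := FiberBundle.extend_apply_self E w'
  have hW : ContMDiffAt I I.tangent ∞ (T% W) x := FiberBundle.contMDiffAt_extend I E w'
  -- The Leibniz rule `[Z, fW] = Z(f) W + f [Z, W]`, on a neighbourhood of `x`.
  have key : ∀ Z : VField I M, ContMDiffAt I I.tangent ∞ (T% Z) x →
      ∀ᶠ y in 𝓝 x, mlieBracket I Z (f • W) y =
        ((fun y ↦ mvfderiv I f y (Z y)) • W + f • mlieBracket I Z W) y := by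
    intro Z hZ
    have h1 := (contMDiffAt_iff_contMDiffAt_nhds (by simp)).mp (hf.of_le (by simp : (1 : ℕ∞ω) ≤ ∞))
    have h2 := (contMDiffAt_iff_contMDiffAt_nhds (by simp)).mp (hW.of_le (by simp : (1 : ℕ∞ω) ≤ ∞))
    filter_upwards [h1, h2] with y hy1 hy2
    rw [mlieBracket_smul_right (hy1.mdifferentiableAt one_ne_zero)
      (hy2.mdifferentiableAt one_ne_zero)]
    rfl
  have br : ∀ {Z : VField I M}, ContMDiffAt I I.tangent ∞ (T% Z) x →
      MDiffAt (T% (mlieBracket I Z W)) x := by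
    intro Z hZ
    exact (ContMDiffAt.mlieBracket_vectorField (m := 1) (n := 2) (hZ.of_le (by simpa using m2))
      (hW.of_le (by simpa using m2)) (by simp; norm_num)).mdifferentiableAt (by simp)
  have hf1 : MDiffAt f x := hf.mdifferentiableAt (by simp)
  have hW1 : MDiffAt (T% W) x := hW.mdifferentiableAt (by simp)
  -- The two terms with first derivatives of `f` are symmetric in `Y` and `Z`, so they cancel in
  -- `[X, [Y, fW]] - [Y, [X, fW]]`.
  have dbl : ∀ {Y Z : VField I M}, ContMDiffAt I I.tangent ∞ (T% Y) x →
      ContMDiffAt I I.tangent ∞ (T% Z) x → MDiffAt (fun y ↦ mvfderiv I f y (Z y)) x →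
      mlieBracket I Y (mlieBracket I Z (f • W)) x =
        mvfderiv I (fun y ↦ mvfderiv I f y (Z y)) x (Y x) • W x
        + mvfderiv I f x (Z x) • mlieBracket I Y W x
        + mvfderiv I f x (Y x) • mlieBracket I Z W x
        + f x • mlieBracket I Y (mlieBracket I Z W) x := by
    intro Y Z hY hZ hZf
    rw [Filter.EventuallyEq.mlieBracket_vectorField_eq (V₁ := Y) (V := Y) EventuallyEq.rfl
      (key Z hZ), mlieBracket_add_right (hZf.smul_section hW1) (hf1.smul_section (br hZ)),
      mlieBracket_smul_right hZf hW1, mlieBracket_smul_right hf1 (br hZ)]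
    module
  have jac := leibniz_identity_mlieBracket_apply (hX.of_le m2) (hY.of_le m2)
    ((hf.smul_section hW).of_le m2)
  have jac' := leibniz_identity_mlieBracket_apply (hX.of_le m2) (hY.of_le m2)
    (hW.of_le m2)
  rw [dbl hX hY hYf, dbl hY hX hXf, mlieBracket_smul_right hf1 hW1, jac', hWx] at jac
  have h0 : (mvfderiv I f x (mlieBracket I X Y x) -
      (mvfderiv I (fun y ↦ mvfderiv I f y (Y y)) x (X x) -
        mvfderiv I (fun y ↦ mvfderiv I f y (X y)) x (Y x))) • w' = 0 := by
    rw [← sub_eq_zero] at jac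
    rw [← neg_zero, ← jac]
    module
  have := (smul_eq_zero.mp h0).resolve_right hw
  linarith

/-- Near `x`, a vector field differentiable at `x` is a combination, with coefficients
differentiable at `x`, of vector fields `e i` that are differentiable at `x` and form a basis
there. It is enough to assume this at `x` alone, because invertibility of the matrix `A` spreads to
nearby points by continuity. -/
theorem mdifferentiableAt_frame_coeff {ι : Type} [Fintype ι] {e : ι → VField I M} {x : M}
    (he : ∀ i, MDiffAt (T% (e i)) x) (hli : LinearIndependent ℝ (fun i ↦ e i x))
    (hcard : Fintype.card ι = Module.finrank ℝ E) {X : VField I M} (hX : MDiffAt (T% X) x) :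
    ∃ a : ι → M → ℝ, (∀ i, MDiffAt (a i) x) ∧ ∀ᶠ y in 𝓝 x, X y = ∑ i, a i y • e i y := by
  have : CompleteSpace E := FiniteDimensional.complete ℝ E
  classical
  set t := trivializationAt E (TangentSpace I : M → Type _) x
  -- `A y` sends coefficients to the combination of the `e i y`, read in the trivialization at `x`.
  let A : M → (ι → ℝ) →L[ℝ] E := fun y ↦
    ∑ i, (ContinuousLinearMap.proj i : (ι → ℝ) →L[ℝ] ℝ).smulRight (t (T% (e i) y)).2
  have hA : MDifferentiableAt I 𝓘(ℝ, (ι → ℝ) →L[ℝ] E) A x := by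
    have h2 : ∀ i ∈ Finset.univ, MDifferentiableAt I 𝓘(ℝ, (ι → ℝ) →L[ℝ] E)
        (fun y ↦ (ContinuousLinearMap.proj i : (ι → ℝ) →L[ℝ] ℝ).smulRight
          (t (T% (e i) y)).2) x := by
      intro i _
      have h1 : MDifferentiableAt I 𝓘(ℝ, E) (fun y ↦ (t (T% (e i) y)).2) x :=
        (mdifferentiableAt_section I _).mp (he i)
      exact ((ContinuousLinearMap.smulRightL ℝ (ι → ℝ) E
        (ContinuousLinearMap.proj i)).mdifferentiableAt).comp x h1
    have h3 : A = ∑ i, fun y ↦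
        (ContinuousLinearMap.proj i : (ι → ℝ) →L[ℝ] ℝ).smulRight (t (T% (e i) y)).2 := by
      ext; simp [A]
    rw [h3]
    exact MDifferentiableAt.sum h2
  have hAa : ∀ y ∈ t.baseSet, ∀ a : ι → ℝ, A y a = (t ⟨y, ∑ i, a i • e i y⟩).2 := by
    intro y hy a
    rw [← Trivialization.continuousLinearMapAt_apply_of_mem (R := ℝ) t hy, map_sum]
    simp [A, hy]
  have hxt : x ∈ t.baseSet := FiberBundle.mem_baseSet_trivializationAt' x
  have hinj : Function.Injective (A x : (ι → ℝ) →ₗ[ℝ] E) := by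
    rw [← LinearMap.ker_eq_bot, LinearMap.ker_eq_bot']
    intro a ha
    have h1 : (t.continuousLinearEquivAt ℝ x hxt) (∑ i, a i • e i x) = 0 := by
      rw [← show A x a = 0 from ha, hAa x hxt]; rfl
    have h2 := (map_eq_zero_iff _ (t.continuousLinearEquivAt ℝ x hxt).injective).mp h1
    exact funext (Fintype.linearIndependent_iff.mp hli a h2)
  let L : (ι → ℝ) ≃L[ℝ] E := (LinearEquiv.ofInjectiveOfFinrankEq _ hinj
    (by simp [hcard])).toContinuousLinearEquiv
  have hL : (L : (ι → ℝ) →L[ℝ] E) = A x := by ext; rfl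
  have hinv : MDifferentiableAt I 𝓘(ℝ, E →L[ℝ] (ι → ℝ)) (fun y ↦ (A y).inverse) x := by
    have h1 : DifferentiableAt ℝ ContinuousLinearMap.inverse (A x) := by
      rw [← hL]
      exact (contDiffAt_map_inverse (n := 1) L).differentiableAt one_ne_zero
    exact h1.mdifferentiableAt.comp x hA
  have hXt : MDifferentiableAt I 𝓘(ℝ, E) (fun y ↦ (t (T% X y)).2) x :=
    (mdifferentiableAt_section I _).mp hX
  have hcoef : MDifferentiableAt I 𝓘(ℝ, ι → ℝ) (fun y ↦ (A y).inverse (t (T% X y)).2) x :=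
    hinv.clm_apply hXt
  refine ⟨fun i y ↦ (A y).inverse (t (T% X y)).2 i, fun i ↦
    ((ContinuousLinearMap.proj i : (ι → ℝ) →L[ℝ] ℝ).mdifferentiableAt).comp x hcoef, ?_⟩
  have hnear : ∀ᶠ y in 𝓝 x, A y ∈ Set.range ((↑) : ((ι → ℝ) ≃L[ℝ] E) → (ι → ℝ) →L[ℝ] E) :=
    hA.continuousAt.eventually (by rw [← hL]; exact L.nhds)
  filter_upwards [hnear, t.open_baseSet.mem_nhds hxt] with y ⟨K, hK⟩ hy
  apply (t.continuousLinearEquivAt ℝ y hy).injective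
  have h1 := hAa y hy ((A y).inverse (t (T% X y)).2)
  rw [← hK] at h1
  simp only [ContinuousLinearMap.inverse_equiv, ContinuousLinearEquiv.coe_coe,
    ContinuousLinearEquiv.apply_symm_apply] at h1
  rw [← hK]
  simp only [ContinuousLinearMap.inverse_equiv]
  exact h1

end General

/-! ### The Koszul formula and the Levi-Civita connection -/

section LeviCivita

variable {E : Type*} [NormedAddCommGroup E] [NormedSpace ℝ E]
  {H : Type*} [TopologicalSpace H] {I : ModelWithCorners ℝ E H}
  {M : Type*} [TopologicalSpace M] [ChartedSpace H M] [IsManifold I ∞ M]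

/-- The two-tensor field `B` is differentiable, in the weak form that `B(X, Y)` is differentiable at
every point where the vector fields `X` and `Y` are. This form is convenient for the metric of the
c-map, which is only given by its values. -/
def DiffTensor (B : TwoTensor I M) : Prop :=
  ∀ (x : M) (X Y : VField I M), MDiffAt (T% X) x → MDiffAt (T% Y) x →
    MDiffAt (fun y ↦ B y (X y) (Y y)) x

theorem TwoTensor.ext_of_nondegenerate {B : TwoTensor I M} {x : M}
    (hB : ∀ v, (∀ w, B x v w = 0) → v = 0) {u v : TangentSpace I x}
    (h : ∀ W : VField I M, MDiffAt (T% W) x → B x u (W x) = B x v (W x)) : u = v := by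
  rw [← sub_eq_zero]
  refine hB _ fun w ↦ ?_
  have := h (FiberBundle.extend E w) (FiberBundle.mdifferentiableAt_extend I E w)
  rw [FiberBundle.extend_apply_self] at this
  simp [this]

theorem mvfderiv_tensor_smul_left {B : TwoTensor I M} (hB : DiffTensor B) {x : M} {f : M → ℝ}
    {X Y : VField I M} (hf : MDiffAt f x) (hX : MDiffAt (T% X) x) (hY : MDiffAt (T% Y) x)
    (v : TangentSpace I x) :
    mvfderiv I (fun y ↦ B y ((f • X) y) (Y y)) x v =
      f x * mvfderiv I (fun y ↦ B y (X y) (Y y)) x v + mvfderiv I f x v * B x (X x) (Y x) := by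
  have e : (fun y ↦ B y ((f • X) y) (Y y)) = fun y ↦ f y * B y (X y) (Y y) := by
    ext y; simp
  rw [e, mvfderiv_fun_mul hf (hB x X Y hX hY)]
  simp; ring

theorem mvfderiv_tensor_smul_right {B : TwoTensor I M} (hB : DiffTensor B) {x : M} {f : M → ℝ}
    {X Y : VField I M} (hf : MDiffAt f x) (hX : MDiffAt (T% X) x) (hY : MDiffAt (T% Y) x)
    (v : TangentSpace I x) :
    mvfderiv I (fun y ↦ B y (X y) ((f • Y) y)) x v =
      f x * mvfderiv I (fun y ↦ B y (X y) (Y y)) x v + mvfderiv I f x v * B x (X x) (Y x) := by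
  have e : (fun y ↦ B y (X y) ((f • Y) y)) = fun y ↦ f y * B y (X y) (Y y) := by
    ext y; simp
  rw [e, mvfderiv_fun_mul hf (hB x X Y hX hY)]
  simp; ring

theorem mvfderiv_tensor_add_left {B : TwoTensor I M} (hB : DiffTensor B) {x : M}
    {X X' Y : VField I M} (hX : MDiffAt (T% X) x) (hX' : MDiffAt (T% X') x)
    (hY : MDiffAt (T% Y) x) (v : TangentSpace I x) :
    mvfderiv I (fun y ↦ B y ((X + X') y) (Y y)) x v =
      mvfderiv I (fun y ↦ B y (X y) (Y y)) x v + mvfderiv I (fun y ↦ B y (X' y) (Y y)) x v := by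
  have e : (fun y ↦ B y ((X + X') y) (Y y)) =
      fun y ↦ B y (X y) (Y y) + B y (X' y) (Y y) := by
    ext y; simp
  rw [e, mvfderiv_fun_add (hB x X Y hX hY) (hB x X' Y hX' hY)]
  simp

theorem mvfderiv_tensor_add_right {B : TwoTensor I M} (hB : DiffTensor B) {x : M}
    {X Y Y' : VField I M} (hX : MDiffAt (T% X) x) (hY : MDiffAt (T% Y) x)
    (hY' : MDiffAt (T% Y') x) (v : TangentSpace I x) :
    mvfderiv I (fun y ↦ B y (X y) ((Y + Y') y)) x v =
      mvfderiv I (fun y ↦ B y (X y) (Y y)) x v + mvfderiv I (fun y ↦ B y (X y) (Y' y)) x v := by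
  have e : (fun y ↦ B y (X y) ((Y + Y') y)) =
      fun y ↦ B y (X y) (Y y) + B y (X y) (Y' y) := by
    ext y; simp
  rw [e, mvfderiv_fun_add (hB x X Y hX hY) (hB x X Y' hX hY')]
  simp

/-- The right-hand side of the Koszul formula, i.e. `B(D_X Y, W)` for the Levi-Civita
connection `D` of `B`. -/
def koszul (B : TwoTensor I M) (X Y W : VField I M) (x : M) : ℝ :=
  (mvfderiv I (fun y ↦ B y (Y y) (W y)) x (X x)
    + mvfderiv I (fun y ↦ B y (X y) (W y)) x (Y x)
    - mvfderiv I (fun y ↦ B y (X y) (Y y)) x (W x)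
    + B x (mlieBracket I X Y x) (W x)
    - B x (mlieBracket I X W x) (Y x)
    - B x (mlieBracket I Y W x) (X x)) / 2

variable [FiniteDimensional ℝ E]

theorem koszul_tensorial_left {B : TwoTensor I M} (hB : DiffTensor B)
    (hs : ∀ x v w, B x v w = B x w v) {x : M} {Y W : VField I M}
    (hY : MDiffAt (T% Y) x) (hW : MDiffAt (T% W) x) :
    TensorialAt I E (fun X ↦ koszul B X Y W x) x where
  smul {f X} hf hX := by
    have := FiniteDimensional.complete ℝ E
    unfold koszul
    simp only [mvfderiv_tensor_smul_left hB hf hX hW,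
      mvfderiv_tensor_smul_left hB hf hX hY]
    simp only [mlieBracket_smul_left hf hX, Pi.smul_apply', map_add, map_smul, smul_eq_mul,
      _root_.add_apply, _root_.smul_apply]
    rw [hs x (X x) (W x), hs x (X x) (Y x), hs x (W x) (X x), hs x (X x) (W x)]
    ring
  add {X X'} hX hX' := by
    have := FiniteDimensional.complete ℝ E
    unfold koszul
    simp only [mvfderiv_tensor_add_left hB hX hX' hW,
      mvfderiv_tensor_add_left hB hX hX' hY]
    simp only [mlieBracket_add_left hX hX', Pi.add_apply, map_add, _root_.add_apply]
    ring

theorem koszul_tensorial_right {B : TwoTensor I M} (hB : DiffTensor B)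
    (hs : ∀ x v w, B x v w = B x w v) {x : M} {X Y : VField I M}
    (hX : MDiffAt (T% X) x) (hY : MDiffAt (T% Y) x) :
    TensorialAt I E (fun W ↦ koszul B X Y W x) x where
  smul {f W} hf hW := by
    have := FiniteDimensional.complete ℝ E
    unfold koszul
    simp only [mvfderiv_tensor_smul_right hB hf hX hW,
      mvfderiv_tensor_smul_right hB hf hY hW]
    simp only [mlieBracket_smul_right hf hW, Pi.smul_apply', map_add, map_smul, smul_eq_mul,
      _root_.add_apply, _root_.smul_apply]
    rw [hs x (W x) (X x), hs x (W x) (Y x)]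
    ring
  add {W W'} hW hW' := by
    have := FiniteDimensional.complete ℝ E
    unfold koszul
    simp only [mvfderiv_tensor_add_right hB hX hW hW',
      mvfderiv_tensor_add_right hB hY hW hW']
    simp only [mlieBracket_add_right hW hW', Pi.add_apply, map_add, _root_.add_apply]
    ring

/-- The Koszul expression satisfies the Leibniz rule in the differentiated field `Y`; the term with
`df(W)` cancels. -/
theorem koszul_smul_middle {B : TwoTensor I M} (hB : DiffTensor B)
    (hs : ∀ x v w, B x v w = B x w v) {x : M} {X Y W : VField I M} {f : M → ℝ}
    (hf : MDiffAt f x) (hX : MDiffAt (T% X) x) (hY : MDiffAt (T% Y) x) (hW : MDiffAt (T% W) x) :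
    koszul B X (f • Y) W x =
      f x * koszul B X Y W x + mvfderiv I f x (X x) * B x (Y x) (W x) := by
  have := FiniteDimensional.complete ℝ E
  unfold koszul
  simp only [mvfderiv_tensor_smul_left hB hf hY hW,
      mvfderiv_tensor_smul_right hB hf hX hY]
  simp only [mlieBracket_smul_right hf hY, mlieBracket_smul_left hf hY, Pi.smul_apply',
    map_add, map_smul, smul_eq_mul, _root_.add_apply, _root_.smul_apply]
  rw [hs x (X x) (Y x)]
  ring

theorem koszul_add_middle {B : TwoTensor I M} (hB : DiffTensor B) {x : M} {X Y Y' W : VField I M}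
    (hX : MDiffAt (T% X) x) (hY : MDiffAt (T% Y) x) (hY' : MDiffAt (T% Y') x)
    (hW : MDiffAt (T% W) x) :
    koszul B X (Y + Y') W x = koszul B X Y W x + koszul B X Y' W x := by
  have := FiniteDimensional.complete ℝ E
  unfold koszul
  simp only [mvfderiv_tensor_add_left hB hY hY' hW,
      mvfderiv_tensor_add_right hB hX hY hY']
  simp only [mlieBracket_add_right hY hY', mlieBracket_add_left hY hY', Pi.add_apply, map_add,
    _root_.add_apply]
  ring

/-- Every differentiable nondegenerate symmetric two-tensor field has a Levi-Civita connection,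
obtained by solving the Koszul formula pointwise. -/
theorem exists_isLeviCivita {B : TwoTensor I M} (hB : DiffTensor B)
    (hs : ∀ x v w, B x v w = B x w v) (hn : ∀ x v, (∀ w, B x v w = 0) → v = 0) :
    ∃ D : AffineConnection I M, IsLeviCivita B D := by
  classical
  have hc := FiniteDimensional.complete ℝ E
  -- The value at fields that are not differentiable at `x` is arbitrary.
  let D : VField I M → Π x : M, TangentSpace I x →L[ℝ] TangentSpace I x := fun Y x ↦
    if hY : MDiffAt (T% Y) x then
      (inverseTensor B x) ∘L (TensorialAt.mkHom₂ (fun X W ↦ koszul B X Y W x) x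
        (fun W hW ↦ koszul_tensorial_left hB hs hY hW)
        (fun X hX ↦ koszul_tensorial_right hB hs hX hY))
    else 0
  have hD : ∀ {x : M} {X Y W : VField I M}, MDiffAt (T% X) x → MDiffAt (T% Y) x →
      MDiffAt (T% W) x → B x (D Y x (X x)) (W x) = koszul B X Y W x := by
    intro x X Y W hX hY hW
    simp only [D, dif_pos hY, ContinuousLinearMap.comp_apply]
    rw [(inverseTensor_spec B x (hn x)).2]
    exact TensorialAt.mkHom₂_apply _ _ hX hW
  have hext : ∀ (x : M) (v : TangentSpace I x), MDiffAt (T% (FiberBundle.extend E v)) x :=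
    fun x v ↦ FiberBundle.mdifferentiableAt_extend I E v
  refine ⟨⟨D, ⟨?_, ?_⟩⟩, ?_, ?_⟩
  · intro Y Y' x hY hY' _
    ext v
    refine TwoTensor.ext_of_nondegenerate (hn x) fun W hW ↦ ?_
    have hv := hext x v
    rw [← FiberBundle.extend_apply_self E v, _root_.add_apply, map_add,
      _root_.add_apply, hD hv hY hW, hD hv hY' hW,
      hD hv (mdifferentiableAt_add_section hY hY') hW, koszul_add_middle hB hv hY hY' hW]
  · intro Y f x hY hf _
    ext v
    refine TwoTensor.ext_of_nondegenerate (hn x) fun W hW ↦ ?_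
    have hv := hext x v
    have h1 := hD hv (hf.smul_section hY) hW
    have h2 := hD hv hY hW
    rw [koszul_smul_middle hB hs hf hv hY hW, ← h2] at h1
    rw [FiberBundle.extend_apply_self] at h1
    simp [h1]
  · refine (CovariantDerivative.torsion_eq_zero_iff _).mpr fun {X Y x} hX hY ↦ ?_
    refine TwoTensor.ext_of_nondegenerate (hn x) fun W hW ↦ ?_
    change B x (D Y x (X x) - D X x (Y x)) (W x) = _
    rw [map_sub, _root_.sub_apply, hD hX hY hW, hD hY hX hW]
    have h1 : (fun y ↦ B y (Y y) (X y)) = fun y ↦ B y (X y) (Y y) := funext fun y ↦ hs y _ _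
    simp only [koszul, h1]
    rw [mlieBracket_swap_apply (V := Y) (W := X)]
    simp only [map_neg, _root_.neg_apply]
    ring
  · intro x Y W hY hW v
    have hv := hext x v
    change _ = B x (D Y x v) (W x) + B x (Y x) (D W x v)
    have h2 := hD hv hY hW
    have h3 := hD hv hW hY
    rw [FiberBundle.extend_apply_self] at h2 h3
    rw [hs x (Y x), h2, h3]
    have h1 : (fun y ↦ B y (W y) (Y y)) = fun y ↦ B y (Y y) (W y) := funext fun y ↦ hs y _ _
    simp only [koszul, h1]
    rw [mlieBracket_swap_apply (V := W) (W := Y)]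
    simp only [map_neg, _root_.neg_apply, FiberBundle.extend_apply_self]
    ring

end LeviCivita

/-! ### Conical special Kähler manifolds -/

section Conical

variable {E : Type*} [NormedAddCommGroup E] [NormedSpace ℝ E]
  {H : Type*} [TopologicalSpace H] {I : ModelWithCorners ℝ E H}
  {M : Type*} [TopologicalSpace M] [ChartedSpace H M] [IsManifold I ∞ M]

theorem EndField.mdifferentiableAt_apply {J : EndField I M}
    (hJ : ContMDiff I (I.prod 𝓘(ℝ, E →L[ℝ] E)) ∞
      (fun x ↦ TotalSpace.mk' (E →L[ℝ] E) x (J x))) {X : VField I M} {x : M}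
    (hX : MDiffAt (T% X) x) : MDiffAt (T% (fun y ↦ J y (X y))) x :=
  MDifferentiableAt.clm_bundle_apply ((hJ x).mdifferentiableAt (by simp)) hX

theorem EndField.contMDiff_apply {J : EndField I M}
    (hJ : ContMDiff I (I.prod 𝓘(ℝ, E →L[ℝ] E)) ∞
      (fun x ↦ TotalSpace.mk' (E →L[ℝ] E) x (J x))) {X : VField I M}
    (hX : ContMDiff I I.tangent ∞ (T% X)) :
    ContMDiff I I.tangent ∞ (T% (fun y ↦ J y (X y))) :=
  ContMDiff.clm_bundle_apply hJ hX

/-- The two-tensor field `B` is smooth, in the weak form that `B(X, Y)` is smooth for all smooth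
global vector fields `X` and `Y`. -/
def IsSmoothTensor (B : TwoTensor I M) : Prop :=
  ∀ X Y : VField I M, ContMDiff I I.tangent ∞ (T% X) → ContMDiff I I.tangent ∞ (T% Y) →
    ContMDiff I 𝓘(ℝ, ℝ) ∞ (fun x ↦ B x (X x) (Y x))

theorem TwoTensor.isSmoothTensor {B : TwoTensor I M}
    (hB : ContMDiff I (I.prod 𝓘(ℝ, E →L[ℝ] E →L[ℝ] ℝ)) ∞
      (fun x ↦ TotalSpace.mk' (E →L[ℝ] E →L[ℝ] ℝ) x (B x))) : IsSmoothTensor B := by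
  intro X Y hX hY x
  have := ContMDiffAt.clm_bundle_apply₂ (F₁ := E) (F₂ := E) (F₃ := ℝ)
    (E₁ := (TangentSpace I : M → Type _)) (E₂ := (TangentSpace I : M → Type _))
    (E₃ := Bundle.Trivial M ℝ) (hB x) (hX x) (hY x)
  rw [contMDiffAt_totalSpace] at this
  exact this.2

theorem TwoTensor.diffTensor {B : TwoTensor I M}
    (hB : ContMDiff I (I.prod 𝓘(ℝ, E →L[ℝ] E →L[ℝ] ℝ)) ∞
      (fun x ↦ TotalSpace.mk' (E →L[ℝ] E →L[ℝ] ℝ) x (B x))) : DiffTensor B := by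
  intro x X Y hX hY
  have := MDifferentiableAt.clm_bundle_apply₂ (F₁ := E) (F₂ := E) (F₃ := ℝ)
    (E₁ := (TangentSpace I : M → Type _)) (E₂ := (TangentSpace I : M → Type _))
    (E₃ := Bundle.Trivial M ℝ) ((hB x).mdifferentiableAt (by simp)) hX hY
  rw [mdifferentiableAt_totalSpace] at this
  exact this.2

theorem exists_mdifferentiableAt_eq {x : M} (v : TangentSpace I x) :
    ∃ X : VField I M, MDiffAt (T% X) x ∧ X x = v :=
  ⟨FiberBundle.extend E v, FiberBundle.mdifferentiableAt_extend I E v,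
    FiberBundle.extend_apply_self E v⟩

variable [FiniteDimensional ℝ E]

theorem IsTorsionFree.sub_eq {D : AffineConnection I M} (hD : IsTorsionFree D) {x : M}
    {X Y : VField I M} (hX : MDiffAt (T% X) x) (hY : MDiffAt (T% Y) x) :
    D Y x (X x) - D X x (Y x) = mlieBracket I X Y x := by
  have := FiniteDimensional.complete ℝ E
  exact (CovariantDerivative.torsion_eq_zero_iff D).mp hD hX hY

namespace IsConicalSpecialKahler

variable {g : TwoTensor I M} {J : EndField I M} {nabla : AffineConnection I M} {ξ : VField I M}
  {x : M} {Y W : VField I M}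

theorem diffTensor (hM : IsConicalSpecialKahler g J nabla ξ)
    : DiffTensor g := TwoTensor.diffTensor hM.kahler.metric.smooth

theorem mdiff_xi (hM : IsConicalSpecialKahler g J nabla ξ)
    : MDiffAt (T% ξ) x := (hM.smooth_xi x).mdifferentiableAt (by simp)

theorem mdiff_J (hM : IsConicalSpecialKahler g J nabla ξ)
    (hY : MDiffAt (T% Y) x) : MDiffAt (T% (fun y ↦ J y (Y y))) x :=
  EndField.mdifferentiableAt_apply hM.kahler.smooth hY

theorem nabla_apply_xi (hM : IsConicalSpecialKahler g J nabla ξ) (hY : MDiffAt (T% Y) x) :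
    nabla Y x (ξ x) = mlieBracket I ξ Y x + Y x := by
  rw [← hM.torsionFree.sub_eq hM.mdiff_xi hY, hM.nabla_xi]
  abel

/-- `L_ξ g = 2 g`, since `Dξ = Id` for the Levi-Civita connection `D`. -/
theorem mvfderiv_metric_xi (hM : IsConicalSpecialKahler g J nabla ξ)
    (hY : MDiffAt (T% Y) x) (hW : MDiffAt (T% W) x) :
    mvfderiv I (fun y ↦ g y (Y y) (W y)) x (ξ x) =
      g x (mlieBracket I ξ Y x) (W x) + g x (Y x) (mlieBracket I ξ W x)
        + 2 * g x (Y x) (W x) := by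
  obtain ⟨D, ⟨hT, hg⟩, hξ⟩ := hM.leviCivita_xi
  rw [hg x Y W hY hW, ← hT.sub_eq hM.mdiff_xi hY, ← hT.sub_eq hM.mdiff_xi hW, hξ, hξ]
  simp
  ring

/-- `L_ξ ω = 2 ω`, since `ω` is parallel and `∇ξ = Id`. -/
theorem mvfderiv_form_xi (hM : IsConicalSpecialKahler g J nabla ξ)
    (hY : MDiffAt (T% Y) x) (hW : MDiffAt (T% W) x) :
    mvfderiv I (fun y ↦ g y (J y (Y y)) (W y)) x (ξ x) =
      g x (J x (mlieBracket I ξ Y x)) (W x) + g x (J x (Y x)) (mlieBracket I ξ W x)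
        + 2 * g x (J x (Y x)) (W x) := by
  have := hM.parallel_form x Y W hY hW (ξ x)
  rw [hM.nabla_apply_xi hY, hM.nabla_apply_xi hW] at this
  simp only [fundamentalForm, ContinuousLinearMap.comp_apply, map_add, _root_.add_apply] at this
  rw [this]
  ring

/-- `L_ξ J = 0`: both `g` and `ω` are homogeneous of degree two under the flow of `ξ`. -/
theorem mlieBracket_xi_J (hM : IsConicalSpecialKahler g J nabla ξ) (hY : MDiffAt (T% Y) x) :
    mlieBracket I ξ (fun y ↦ J y (Y y)) x = J x (mlieBracket I ξ Y x) := by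
  refine TwoTensor.ext_of_nondegenerate (hM.kahler.metric.nondegenerate x) fun W hW ↦ ?_
  have h1 := hM.mvfderiv_metric_xi (hM.mdiff_J hY) hW
  rw [hM.mvfderiv_form_xi hY hW] at h1
  linarith

/-- `∇Z = J` for `Z = Jξ`: this is `d^∇ J = 0` evaluated on `V` and `ξ`, given `L_ξ J = 0`. -/
theorem nabla_J_xi (hM : IsConicalSpecialKahler g J nabla ξ)
    (v : TangentSpace I x) : nabla (fun y ↦ J y (ξ y)) x v = J x v := by
  obtain ⟨V, hV, rfl⟩ := exists_mdifferentiableAt_eq v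
  have h1 := hM.closed_J x V ξ hV hM.mdiff_xi
  rw [hM.nabla_apply_xi (hM.mdiff_J hV), hM.mlieBracket_xi_J hV, mlieBracket_swap_apply,
    map_neg] at h1
  rw [← sub_eq_zero, ← h1]
  abel

/-- `L_Z J = 0` for `Z = Jξ`, by integrability of `J`. -/
theorem mlieBracket_J_xi_J (hM : IsConicalSpecialKahler g J nabla ξ) (hY : MDiffAt (T% Y) x) :
    mlieBracket I (fun y ↦ J y (ξ y)) (fun y ↦ J y (Y y)) x =
      J x (mlieBracket I (fun y ↦ J y (ξ y)) Y x) := by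
  have h1 := hM.kahler.integrable x ξ Y hM.mdiff_xi hY
  rw [hM.mlieBracket_xi_J hY, hM.kahler.sq] at h1
  rw [← sub_eq_zero, ← h1]
  abel

/-- `∇_Z = L_Z + J` on vector fields, for `Z = Jξ`. -/
theorem nabla_apply_J_xi (hM : IsConicalSpecialKahler g J nabla ξ) (hY : MDiffAt (T% Y) x) :
    nabla Y x (J x (ξ x)) = mlieBracket I (fun y ↦ J y (ξ y)) Y x + J x (Y x) := by
  rw [← hM.torsionFree.sub_eq (hM.mdiff_J hM.mdiff_xi) hY, hM.nabla_J_xi]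
  abel

/-- `Z = Jξ` is a Killing field of `g`. Since `g(Y, W) = -ω(JY, W)` and `ω` is parallel, this
follows from `∇_Z = L_Z + J`, `L_Z J = 0` and the skewness of `J`. -/
theorem mvfderiv_metric_J_xi (hM : IsConicalSpecialKahler g J nabla ξ)
    (hY : MDiffAt (T% Y) x) (hW : MDiffAt (T% W) x) :
    mvfderiv I (fun y ↦ g y (Y y) (W y)) x (J x (ξ x)) =
      g x (mlieBracket I (fun y ↦ J y (ξ y)) Y x) (W x)
        + g x (Y x) (mlieBracket I (fun y ↦ J y (ξ y)) W x) := by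
  have hJY := hM.mdiff_J hY
  have h1 := hM.parallel_form x _ W hJY hW (J x (ξ x))
  rw [hM.nabla_apply_J_xi hJY, hM.nabla_apply_J_xi hW, hM.mlieBracket_J_xi_J hY] at h1
  simp only [fundamentalForm, ContinuousLinearMap.comp_apply, map_add, _root_.add_apply,
    hM.kahler.sq, map_neg, _root_.neg_apply] at h1
  have h2 : (fun y ↦ -g y (Y y) (W y)) = -fun y ↦ g y (Y y) (W y) := rfl
  rw [h2, mvfderiv_neg, _root_.neg_apply] at h1
  rw [hM.kahler.skew x (Y x)] at h1
  linarith

/-- `∇_Z g = 0` for `Z = Jξ`: it differs from `L_Z g` by `g(JY, W) + g(Y, JW)`, which vanishes. -/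
theorem mvfderiv_metric_nabla_J_xi (hM : IsConicalSpecialKahler g J nabla ξ)
    (hY : MDiffAt (T% Y) x) (hW : MDiffAt (T% W) x) :
    mvfderiv I (fun y ↦ g y (Y y) (W y)) x (J x (ξ x)) =
      g x (nabla Y x (J x (ξ x))) (W x) + g x (Y x) (nabla W x (J x (ξ x))) := by
  rw [hM.mvfderiv_metric_J_xi hY hW, hM.nabla_apply_J_xi hY, hM.nabla_apply_J_xi hW]
  simp only [map_add, _root_.add_apply, hM.kahler.skew x (Y x)]
  ring

/-- `g(ξ, ξ)` has gradient `2ξ`. -/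
theorem mvfderiv_metric_xi_xi (hM : IsConicalSpecialKahler g J nabla ξ)
    (v : TangentSpace I x) :
    mvfderiv I (fun y ↦ g y (ξ y) (ξ y)) x v = 2 * g x (ξ x) v := by
  obtain ⟨D, ⟨hT, hg⟩, hξ⟩ := hM.leviCivita_xi
  rw [hg x ξ ξ hM.mdiff_xi hM.mdiff_xi, hξ, hM.kahler.metric.symm x v]
  ring

theorem metric_J_J (hM : IsConicalSpecialKahler g J nabla ξ)
    (v w : TangentSpace I x) : g x (J x v) (J x w) = g x v w := by
  rw [hM.kahler.skew, hM.kahler.sq]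
  simp

theorem metric_J_xi_ne_zero (hM : IsConicalSpecialKahler g J nabla ξ)
    (x : M) : g x (J x (ξ x)) (J x (ξ x)) ≠ 0 := by
  have hmem : J x (ξ x) ∈ Submodule.span ℝ {ξ x, J x (ξ x)} :=
    Submodule.subset_span (by simp)
  have hne : J x (ξ x) ≠ 0 := by
    simpa using (hM.plane x).ne_zero 1
  rcases hM.definite x with h | h
  · exact (h _ hmem hne).ne'
  · exact (h _ hmem hne).ne

end IsConicalSpecialKahler

end Conical

/-! ### Smoothness of vector fields through coordinate functions -/

section Coordinates

variable {E : Type*} [NormedAddCommGroup E] [NormedSpace ℝ E]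
  {H : Type*} [TopologicalSpace H] {I : ModelWithCorners ℝ E H}
  {M : Type*} [TopologicalSpace M] [ChartedSpace H M]

theorem contMDiffAt_of_forall_clm {G : Type*} [NormedAddCommGroup G] [NormedSpace ℝ G]
    [FiniteDimensional ℝ G] {n : ℕ∞ω} {f : M → G} {x : M}
    (h : ∀ l : G →L[ℝ] ℝ, ContMDiffAt I 𝓘(ℝ, ℝ) n (fun y ↦ l (f y)) x) :
    ContMDiffAt I 𝓘(ℝ, G) n f x := by
  let e := (Module.finBasis ℝ G).equivFunL
  have h1 : ContMDiffAt I 𝓘(ℝ, Fin (Module.finrank ℝ G) → ℝ) n (fun y ↦ e (f y)) x :=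
    contMDiffAt_pi_space.mpr fun i ↦
      h ((ContinuousLinearMap.proj i : (Fin (Module.finrank ℝ G) → ℝ) →L[ℝ] ℝ) ∘L e)
  have h2 := (e.symm : (Fin (Module.finrank ℝ G) → ℝ) →L[ℝ] G).contMDiff.contMDiffAt.comp x h1
  simpa [Function.comp_def] using h2

theorem Filter.EventuallyEq.mvfderiv_eq {f₁ f₂ : M → ℝ} {x : M} (h : f₁ =ᶠ[𝓝 x] f₂) :
    mvfderiv I f₁ x = mvfderiv I f₂ x := by
  ext v
  exact congr($(h.mfderiv_eq (I := I) (I' := 𝓘(ℝ, ℝ))) v)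

theorem contMDiffAt_clm_extChartAt (x : M) (l : E →L[ℝ] ℝ) :
    ContMDiffAt I 𝓘(ℝ, ℝ) ∞ (fun z ↦ l (extChartAt I x z)) x :=
  l.contMDiff.contMDiffAt.comp x contMDiffAt_extChartAt

variable [IsManifold I ∞ M]

theorem mvfderiv_clm_extChartAt {x y : M} (hy : y ∈ (chartAt H x).source) (l : E →L[ℝ] ℝ)
    (v : TangentSpace I y) :
    mvfderiv I (fun z ↦ l (extChartAt I x z)) y v =
      l (trivializationAt E (TangentSpace I : M → Type _) x ⟨y, v⟩).2 := by
  have h1 := mvfderiv_comp_apply (g := l) (f := extChartAt I x) (I := 𝓘(ℝ, E)) (I' := I) y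
    l.mdifferentiableAt (mdifferentiableAt_extChartAt hy) v
  have h2 : y ∈ (trivializationAt E (TangentSpace I : M → Type _) x).baseSet := by simpa using hy
  rw [← Trivialization.continuousLinearMapAt_apply_of_mem (R := ℝ) _ h2,
    TangentBundle.continuousLinearMapAt_trivializationAt hy]
  refine h1.trans ?_
  rw [mvfderiv, l.mfderiv_eq]
  rfl

theorem contMDiffAt_mvfderiv_clm_extChartAt {x : M} (l : E →L[ℝ] ℝ) {X : VField I M}
    (hX : ContMDiffAt I I.tangent ∞ (T% X) x) :
    ContMDiffAt I 𝓘(ℝ, ℝ) ∞ (fun y ↦ mvfderiv I (fun z ↦ l (extChartAt I x z)) y (X y)) x := by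
  have h1 := (contMDiffAt_section _).mp hX
  refine (l.contMDiff.contMDiffAt.comp x h1).congr_of_eventuallyEq ?_
  filter_upwards [(chartAt H x).open_source.mem_nhds (mem_chart_source H x)] with y hy
  exact mvfderiv_clm_extChartAt hy l (X y)

/-- A vector field is smooth if it takes coordinate functions to smooth functions. -/
theorem contMDiffAt_vfield_of_forall_clm [FiniteDimensional ℝ E] {U : VField I M} {x : M}
    (h : ∀ l : E →L[ℝ] ℝ,
      ContMDiffAt I 𝓘(ℝ, ℝ) ∞ (fun y ↦ mvfderiv I (fun z ↦ l (extChartAt I x z)) y (U y)) x) :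
    ContMDiffAt I I.tangent ∞ (T% U) x := by
  refine (contMDiffAt_section _).mpr (contMDiffAt_of_forall_clm fun l ↦ ?_)
  refine ContMDiffAt.congr_of_eventuallyEq (h l) ?_
  filter_upwards [(chartAt H x).open_source.mem_nhds (mem_chart_source H x)] with y hy
  exact (mvfderiv_clm_extChartAt hy l (U y)).symm

theorem tangent_ext_of_forall_clm [FiniteDimensional ℝ E] {x : M} {u v : TangentSpace I x}
    (h : ∀ l : E →L[ℝ] ℝ, mvfderiv I (fun z ↦ l (extChartAt I x z)) x u =
      mvfderiv I (fun z ↦ l (extChartAt I x z)) x v) : u = v := by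
  have hx : x ∈ (trivializationAt E (TangentSpace I : M → Type _) x).baseSet :=
    FiberBundle.mem_baseSet_trivializationAt' x
  apply ((trivializationAt E (TangentSpace I : M → Type _) x).continuousLinearEquivAt ℝ x
    hx).injective
  refine (SeparatingDual.eq_iff_forall_dual_eq (R := ℝ) (V := E)).mpr fun l ↦ ?_
  have := h l
  rw [mvfderiv_clm_extChartAt (mem_chart_source H x),
    mvfderiv_clm_extChartAt (mem_chart_source H x)] at this
  exact this

end Coordinates

/-! ### Functions and vector fields on the cotangent bundle -/

section Cotangent

variable {E : Type*} [NormedAddCommGroup E] [NormedSpace ℝ E]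
  {M : Type*} [TopologicalSpace M] [ChartedSpace E M] [IsManifold 𝓘(ℝ, E) ∞ M]

theorem contMDiff_momentum {X : VField 𝓘(ℝ, E) M}
    (hX : ContMDiff 𝓘(ℝ, E) 𝓘(ℝ, E).tangent ∞ (T% X)) :
    ContMDiff (cotangentModel E) 𝓘(ℝ, ℝ) ∞ (momentum X) := by
  intro p
  have h1 : ContMDiffAt (cotangentModel E) (𝓘(ℝ, E).prod 𝓘(ℝ, E →L[ℝ] ℝ)) ∞
      (fun q : CotangentBundle E M ↦ TotalSpace.mk' (E →L[ℝ] ℝ)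
        (E := fun x : M ↦ TangentSpace 𝓘(ℝ, E) x →L[ℝ] Bundle.Trivial M ℝ x) q.proj q.2) p :=
    contMDiffAt_id
  have h2 : ContMDiffAt (cotangentModel E) (𝓘(ℝ, E).prod 𝓘(ℝ, E)) ∞
      (fun q : CotangentBundle E M ↦ TotalSpace.mk' E
        (E := fun x : M ↦ TangentSpace 𝓘(ℝ, E) x) q.proj (X q.proj)) p :=
    ContMDiffAt.comp p (hX p.proj) (contMDiffAt_proj _)
  have h3 := ContMDiffAt.clm_bundle_apply (F₁ := E) (F₂ := ℝ)
    (E₁ := fun x : M ↦ TangentSpace 𝓘(ℝ, E) x) (E₂ := Bundle.Trivial M ℝ)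
    (b := fun q : CotangentBundle E M ↦ q.proj) (ϕ := fun q : CotangentBundle E M ↦ q.2)
    (v := fun q : CotangentBundle E M ↦ X q.proj) h1 h2
  rw [contMDiffAt_totalSpace] at h3
  exact h3.2

theorem mvfderiv_comp_proj {f : M → ℝ} {p : CotangentBundle E M} (hf : MDiffAt f p.proj)
    (u : TangentSpace (cotangentModel E) p) :
    mvfderiv (cotangentModel E) (fun q : CotangentBundle E M ↦ f q.proj) p u =
      mvfderiv 𝓘(ℝ, E) f p.proj (cotangentProj p u) :=
  mvfderiv_comp_apply (f := (TotalSpace.proj : CotangentBundle E M → M)) p hf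
    (mdifferentiableAt_cotangentProj p) u

/-- Every linear function of the canonical coordinates on `T*M` is near `p` the sum of a function
on `M` and the momentum of a vector field. -/
theorem exists_extChartAt_cotangent_eq [FiniteDimensional ℝ E] (p : CotangentBundle E M)
    (l : E × (E →L[ℝ] ℝ) →L[ℝ] ℝ) :
    ∃ (l₁ : E →L[ℝ] ℝ) (w : TangentSpace 𝓘(ℝ, E) p.proj),
      ∀ᶠ q in 𝓝 p, l (extChartAt (cotangentModel E) p q) =
        l₁ (extChartAt 𝓘(ℝ, E) p.proj q.proj) + momentum (FiberBundle.extend E w) q := by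
  let e : E := (Module.evalEquiv ℝ E).symm
    ((l ∘L ContinuousLinearMap.inr ℝ E (E →L[ℝ] ℝ)).toLinearMap ∘ₗ
      (LinearMap.toContinuousLinearMap (𝕜 := ℝ) (E := E) (F' := ℝ)).toLinearMap)
  have he : ∀ β : E →L[ℝ] ℝ, l (0, β) = β e := by
    intro β
    have h1 : Module.evalEquiv ℝ E e (β : E →ₗ[ℝ] ℝ) = l (0, β) := by
      simp only [e, LinearEquiv.apply_symm_apply]
      rfl
    rw [← h1]; rfl
  have hl : ∀ z : E × (E →L[ℝ] ℝ), l z = l (z.1, 0) + z.2 e := by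
    intro z
    rw [← he, ← map_add]
    simp
  set w : TangentSpace 𝓘(ℝ, E) p.proj :=
    (trivializationAt E (TangentSpace 𝓘(ℝ, E)) p.proj).symm p.proj e with hw
  refine ⟨l ∘L ContinuousLinearMap.inl ℝ E (E →L[ℝ] ℝ), w, ?_⟩
  have hU : ∀ᶠ q : CotangentBundle E M in nhds p,
      q.proj ∈ (trivializationAt E (TangentSpace 𝓘(ℝ, E)) p.proj).baseSet :=
    (FiberBundle.continuous_proj _ _).continuousAt.eventually
      ((trivializationAt E (TangentSpace 𝓘(ℝ, E)) p.proj).open_baseSet.mem_nhds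
        (FiberBundle.mem_baseSet_trivializationAt' p.proj))
  filter_upwards [hU] with q hq
  rw [hl, FiberBundle.extChartAt]
  have hwe : (trivializationAt E (TangentSpace 𝓘(ℝ, E)) p.proj ⟨p.proj, w⟩).2 = e := by
    rw [hw, Trivialization.apply_mk_symm _ (FiberBundle.mem_baseSet_trivializationAt' p.proj)]
  simp only [momentum, FiberBundle.extend, hwe]
  simp [hom_trivializationAt_apply, ContinuousLinearMap.inCoordinates]
  exact congrArg q.2 (Trivialization.symmL_apply (R := ℝ) _ hq e)

/-- A vector field on `T*M` that projects to a smooth vector field on `M` is smooth if it takes the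
momenta of smooth vector fields to smooth functions. -/
theorem contMDiff_vfield_cotangent [FiniteDimensional ℝ E] [T2Space M]
    {U : VField (cotangentModel E) (CotangentBundle E M)} {X : VField 𝓘(ℝ, E) M}
    (hX : ContMDiff 𝓘(ℝ, E) 𝓘(ℝ, E).tangent ∞ (T% X))
    (hUX : ∀ p, cotangentProj p (U p) = X p.proj)
    (hU : ∀ W : VField 𝓘(ℝ, E) M, ContMDiff 𝓘(ℝ, E) 𝓘(ℝ, E).tangent ∞ (T% W) →
      ContMDiff (cotangentModel E) 𝓘(ℝ, ℝ) ∞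
        (fun p ↦ mvfderiv (cotangentModel E) (momentum W) p (U p))) :
    ContMDiff (cotangentModel E) (cotangentModel E).tangent ∞ (T% U) := by
  intro p
  refine contMDiffAt_vfield_of_forall_clm fun l ↦ ?_
  obtain ⟨l₁, w, hlw⟩ := exists_extChartAt_cotangent_eq p l
  obtain ⟨W, hW, hWw⟩ := exists_contMDiff_eventuallyEq_extend w
  have hproj : ContinuousAt (TotalSpace.proj : CotangentBundle E M → M) p :=
    (FiberBundle.continuous_proj _ _).continuousAt
  have h1 : ∀ᶠ q in 𝓝 p, l (extChartAt (cotangentModel E) p q) =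
      l₁ (extChartAt 𝓘(ℝ, E) p.proj q.proj) + momentum W q := by
    filter_upwards [hlw, hproj.eventually hWw] with q hq hq'
    rw [hq, momentum, momentum, hq']
  have h2 := (contMDiffAt_mvfderiv_clm_extChartAt l₁ (hX p.proj)).comp p
    (contMDiffAt_proj (IB := 𝓘(ℝ, E)) (fun x : M ↦ TangentSpace 𝓘(ℝ, E) x →L[ℝ] ℝ))
  refine (h2.add (hU W hW p)).congr_of_eventuallyEq ?_
  filter_upwards [h1.eventually_nhds, hproj.eventually
    ((chartAt E p.proj).open_source.mem_nhds (mem_chart_source E p.proj))] with q hq hqs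
  have hl₁ : MDiffAt (fun z ↦ l₁ (extChartAt 𝓘(ℝ, E) p.proj z)) q.proj :=
    l₁.mdifferentiableAt.comp q.proj (mdifferentiableAt_extChartAt hqs)
  have h3 : mvfderiv (cotangentModel E) (fun z ↦ l (extChartAt (cotangentModel E) p z)) q =
      mvfderiv (cotangentModel E) (fun z : CotangentBundle E M ↦
        l₁ (extChartAt 𝓘(ℝ, E) p.proj z.proj) + momentum W z) q := by
    exact Filter.EventuallyEq.mvfderiv_eq hq
  have h4 : MDifferentiableAt (cotangentModel E) 𝓘(ℝ, ℝ)
      (fun z : CotangentBundle E M ↦ l₁ (extChartAt 𝓘(ℝ, E) p.proj z.proj)) q :=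
    hl₁.comp q (mdifferentiableAt_cotangentProj q)
  rw [h3, mvfderiv_fun_add h4
    (mdifferentiableAt_momentum ((hW q.proj).mdifferentiableAt (by simp))), _root_.add_apply]
  refine congrArg (· + _) ?_
  exact (mvfderiv_comp_proj hl₁ _).trans (by rw [hUX]; rfl)

end Cotangent

/-! ### Horizontal and vertical lifts and their brackets -/

section Lift

variable {E : Type*} [NormedAddCommGroup E] [NormedSpace ℝ E]
  {M : Type*} [TopologicalSpace M] [ChartedSpace E M] [IsManifold 𝓘(ℝ, E) ∞ M]

theorem contMDiff_nabla_apply {nabla : AffineConnection 𝓘(ℝ, E) M}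
    (hn : CovariantDerivative.ContMDiffCovariantDerivative nabla ∞) {X W : VField 𝓘(ℝ, E) M}
    (hX : ContMDiff 𝓘(ℝ, E) 𝓘(ℝ, E).tangent ∞ (T% X))
    (hW : ContMDiff 𝓘(ℝ, E) 𝓘(ℝ, E).tangent ∞ (T% W)) :
    ContMDiff 𝓘(ℝ, E) 𝓘(ℝ, E).tangent ∞ (T% (fun x ↦ nabla W x (X x))) := by
  have h1 := contMDiffOn_univ.mp (hn.contMDiff.contMDiff (σ := W) (contMDiffOn_univ.mpr
    (by simpa using hW)))
  exact ContMDiff.clm_bundle_apply h1 hX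

variable [FiniteDimensional ℝ E]

theorem tangent_cotangent_ext (nabla : AffineConnection 𝓘(ℝ, E) M) {p : CotangentBundle E M}
    {u v : TangentSpace (cotangentModel E) p} (h1 : cotangentProj p u = cotangentProj p v)
    (h2 : connector nabla p u = connector nabla p v) : u = v :=
  (splitting nabla p).injective (Prod.ext h1 h2)

theorem cotangentProj_splitting_symm (nabla : AffineConnection 𝓘(ℝ, E) M)
    (p : CotangentBundle E M)
    (z : TangentSpace 𝓘(ℝ, E) p.proj × (TangentSpace 𝓘(ℝ, E) p.proj →L[ℝ] ℝ)) :
    cotangentProj p ((splitting nabla p).symm z) = z.1 :=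
  congr(($((splitting nabla p).apply_symm_apply z)).1)

theorem connector_splitting_symm (nabla : AffineConnection 𝓘(ℝ, E) M)
    (p : CotangentBundle E M)
    (z : TangentSpace 𝓘(ℝ, E) p.proj × (TangentSpace 𝓘(ℝ, E) p.proj →L[ℝ] ℝ)) :
    connector nabla p ((splitting nabla p).symm z) = z.2 :=
  congr(($((splitting nabla p).apply_symm_apply z)).2)

theorem mvfderiv_momentum (nabla : AffineConnection 𝓘(ℝ, E) M) (p : CotangentBundle E M)
    (u : TangentSpace (cotangentModel E) p) {X : VField 𝓘(ℝ, E) M}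
    (hX : MDiffAt (T% X) p.proj) :
    mvfderiv (cotangentModel E) (momentum X) p u =
      connector nabla p u (X p.proj) + p.2 (nabla X p.proj (cotangentProj p u)) := by
  rw [connector_apply nabla p u hX]
  ring

/-- The vector field on `T*M` with horizontal part `X` and vertical part the one-form `B(Y, ·)`.
Parametrizing vertical parts by vector fields on `M` through a parallel `B` makes both parts of the
same kind. -/
def cotangentLiftPair (nabla : AffineConnection 𝓘(ℝ, E) M) (B : TwoTensor 𝓘(ℝ, E) M)
    (X Y : VField 𝓘(ℝ, E) M) : VField (cotangentModel E) (CotangentBundle E M) :=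
  fun p ↦ (splitting nabla p).symm (X p.proj, B p.proj (Y p.proj))

variable {nabla : AffineConnection 𝓘(ℝ, E) M} {B : TwoTensor 𝓘(ℝ, E) M}
  {X Y Z : VField 𝓘(ℝ, E) M}

theorem cotangentProj_cotangentLiftPair (p : CotangentBundle E M) :
    cotangentProj p (cotangentLiftPair nabla B X Y p) = X p.proj :=
  cotangentProj_splitting_symm ..

theorem connector_cotangentLiftPair (p : CotangentBundle E M) :
    connector nabla p (cotangentLiftPair nabla B X Y p) = B p.proj (Y p.proj) :=
  connector_splitting_symm ..

theorem cotangentLift_eq_cotangentLiftPair :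
    cotangentLift nabla Z = cotangentLiftPair nabla B Z 0 := by
  ext p; simp [cotangentLift, cotangentLiftPair]

/-- The lift of `(X, Y)` acts on momenta by `momentum W ↦ π*(B(Y, W)) + momentum (∇_X W)`. -/
theorem mvfderiv_momentum_cotangentLiftPair {W : VField 𝓘(ℝ, E) M} {p : CotangentBundle E M}
    (hW : MDiffAt (T% W) p.proj) :
    mvfderiv (cotangentModel E) (momentum W) p (cotangentLiftPair nabla B X Y p) =
      B p.proj (Y p.proj) (W p.proj) + momentum (fun x ↦ nabla W x (X x)) p := by
  rw [mvfderiv_momentum nabla p _ hW, cotangentProj_cotangentLiftPair,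
    connector_cotangentLiftPair]
  rfl

/-- Brackets of projectable vector fields on `T*M` project to the brackets of their projections. -/
theorem cotangentProj_mlieBracket {U V : VField (cotangentModel E) (CotangentBundle E M)}
    (hX : ContMDiff 𝓘(ℝ, E) 𝓘(ℝ, E).tangent ∞ (T% X))
    (hY : ContMDiff 𝓘(ℝ, E) 𝓘(ℝ, E).tangent ∞ (T% Y))
    (hU : ContMDiff (cotangentModel E) (cotangentModel E).tangent ∞ (T% U))
    (hV : ContMDiff (cotangentModel E) (cotangentModel E).tangent ∞ (T% V))
    (hUX : ∀ p, cotangentProj p (U p) = X p.proj) (hVY : ∀ p, cotangentProj p (V p) = Y p.proj)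
    (p : CotangentBundle E M) :
    cotangentProj p (mlieBracket (cotangentModel E) U V p) =
      mlieBracket 𝓘(ℝ, E) X Y p.proj := by
  refine tangent_ext_of_forall_clm fun l ↦ ?_
  set f : M → ℝ := fun z ↦ l (extChartAt 𝓘(ℝ, E) p.proj z) with hf
  have hfs : ContMDiffAt 𝓘(ℝ, E) 𝓘(ℝ, ℝ) ∞ f p.proj := contMDiffAt_clm_extChartAt _ l
  have hproj : ContMDiffAt (cotangentModel E) 𝓘(ℝ, E) ∞
      (TotalSpace.proj : CotangentBundle E M → M) p :=
    contMDiffAt_proj (fun x : M ↦ TangentSpace 𝓘(ℝ, E) x →L[ℝ] ℝ)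
  have hev : ∀ᶠ x in 𝓝 p.proj, MDiffAt f x := by
    filter_upwards [(contMDiffAt_iff_contMDiffAt_nhds (n := 1) (by simp)).mp
      (hfs.of_le (by simp))] with x hx
    exact hx.mdifferentiableAt one_ne_zero
  have hd : ∀ {A : VField 𝓘(ℝ, E) M}, ContMDiff 𝓘(ℝ, E) 𝓘(ℝ, E).tangent ∞ (T% A) →
      MDiffAt (fun x ↦ mvfderiv 𝓘(ℝ, E) f x (A x)) p.proj := fun hA ↦
    (contMDiffAt_mvfderiv_clm_extChartAt l (hA p.proj)).mdifferentiableAt (by simp)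
  have hrel : ∀ {A : VField 𝓘(ℝ, E) M} {C : VField (cotangentModel E) (CotangentBundle E M)},
      (∀ p, cotangentProj p (C p) = A p.proj) →
      (fun q ↦ mvfderiv (cotangentModel E) (fun q : CotangentBundle E M ↦ f q.proj) q (C q)) =ᶠ[𝓝 p]
        fun q ↦ mvfderiv 𝓘(ℝ, E) f q.proj (A q.proj) := by
    intro A C hCA
    filter_upwards [hproj.continuousAt.eventually hev] with q hq
    rw [mvfderiv_comp_proj hq, hCA]
  have hdN : ∀ {A : VField 𝓘(ℝ, E) M} {C : VField (cotangentModel E) (CotangentBundle E M)},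
      ContMDiff 𝓘(ℝ, E) 𝓘(ℝ, E).tangent ∞ (T% A) → (∀ p, cotangentProj p (C p) = A p.proj) →
      MDifferentiableAt (cotangentModel E) 𝓘(ℝ, ℝ) (fun q ↦ mvfderiv (cotangentModel E)
        (fun q : CotangentBundle E M ↦ f q.proj) q (C q)) p := fun hA hCA ↦
    (MDifferentiableAt.comp p (hd hA) (mdifferentiableAt_cotangentProj p)).congr_of_eventuallyEq
      (hrel hCA)
  have hfN : ContMDiffAt (cotangentModel E) 𝓘(ℝ, ℝ) ∞ (fun q : CotangentBundle E M ↦ f q.proj) p :=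
    hfs.comp p hproj
  rw [← mvfderiv_comp_proj hev.self_of_nhds, mvfderiv_mlieBracket hfN (hU p) (hV p)
    (hdN hX hUX) (hdN hY hVY), mvfderiv_mlieBracket hfs (hX p.proj) (hY p.proj) (hd hX) (hd hY),
    (hrel hVY).mvfderiv_eq, (hrel hUX).mvfderiv_eq, mvfderiv_comp_proj (hd hY),
    mvfderiv_comp_proj (hd hX), hUX, hVY]

variable [T2Space M]

theorem contMDiff_cotangentLiftPair
    (hn : CovariantDerivative.ContMDiffCovariantDerivative nabla ∞)
    (hB : IsSmoothTensor B)
    (hX : ContMDiff 𝓘(ℝ, E) 𝓘(ℝ, E).tangent ∞ (T% X))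
    (hY : ContMDiff 𝓘(ℝ, E) 𝓘(ℝ, E).tangent ∞ (T% Y)) :
    ContMDiff (cotangentModel E) (cotangentModel E).tangent ∞
      (T% (cotangentLiftPair nabla B X Y)) := by
  refine contMDiff_vfield_cotangent hX cotangentProj_cotangentLiftPair fun W hW ↦ ?_
  have h1 : (fun p ↦ mvfderiv (cotangentModel E) (momentum W) p (cotangentLiftPair nabla B X Y p)) =
      fun p ↦ B p.proj (Y p.proj) (W p.proj) + momentum (fun x ↦ nabla W x (X x)) p :=
    funext fun p ↦ mvfderiv_momentum_cotangentLiftPair ((hW p.proj).mdifferentiableAt (by simp))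
  rw [h1]
  exact ((hB Y W hY hW).comp
    (contMDiff_proj (fun x : M ↦ TangentSpace 𝓘(ℝ, E) x →L[ℝ] ℝ))).add
      (contMDiff_momentum (contMDiff_nabla_apply hn hX hW))

/-- For flat `∇` and parallel `B`, the bracket of the horizontal lift of `Z` with the lift of
`(X, Y)` is the lift of `([Z, X], ∇_Z Y)`. Both sides project to `[Z, X]`; they agree on momenta
because the curvature vanishes and `B` is parallel. -/
theorem mlieBracket_cotangentLiftPair
    (hn : CovariantDerivative.ContMDiffCovariantDerivative nabla ∞)
    (hflat : IsFlatConnection nabla) (hpar : IsParallelTwoTensor nabla B)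
    (hB : IsSmoothTensor B)
    (hZ : ContMDiff 𝓘(ℝ, E) 𝓘(ℝ, E).tangent ∞ (T% Z))
    (hX : ContMDiff 𝓘(ℝ, E) 𝓘(ℝ, E).tangent ∞ (T% X))
    (hY : ContMDiff 𝓘(ℝ, E) 𝓘(ℝ, E).tangent ∞ (T% Y)) (p : CotangentBundle E M) :
    mlieBracket (cotangentModel E) (cotangentLift nabla Z) (cotangentLiftPair nabla B X Y) p =
      cotangentLiftPair nabla B (mlieBracket 𝓘(ℝ, E) Z X) (fun x ↦ nabla Y x (Z x)) p := by
  have hmd : ∀ {A : VField 𝓘(ℝ, E) M}, ContMDiff 𝓘(ℝ, E) 𝓘(ℝ, E).tangent ∞ (T% A) →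
      ∀ x, MDiffAt (T% A) x := fun hA x ↦ (hA x).mdifferentiableAt (by simp)
  have h0 : ContMDiff 𝓘(ℝ, E) 𝓘(ℝ, E).tangent ∞ (T% (0 : VField 𝓘(ℝ, E) M)) :=
    contMDiff_zeroSection ℝ _
  rw [cotangentLift_eq_cotangentLiftPair (B := B)]
  have hU := contMDiff_cotangentLiftPair hn hB hZ h0
  have hV := contMDiff_cotangentLiftPair hn hB hX hY
  have hpr := cotangentProj_mlieBracket hZ hX hU hV
    cotangentProj_cotangentLiftPair cotangentProj_cotangentLiftPair p
  refine tangent_cotangent_ext nabla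
    (hpr.trans (cotangentProj_cotangentLiftPair p).symm) ?_
  rw [connector_cotangentLiftPair]
  ext w
  obtain ⟨W, hW, rfl⟩ := exists_contMDiff_eq w
  have hZW := contMDiff_nabla_apply hn hZ hW
  have hXW := contMDiff_nabla_apply hn hX hW
  have hVW : (fun q ↦ mvfderiv (cotangentModel E) (momentum W) q (cotangentLiftPair nabla B X Y q))
      = fun q ↦ B q.proj (Y q.proj) (W q.proj) + momentum (fun x ↦ nabla W x (X x)) q :=
    funext fun q ↦ mvfderiv_momentum_cotangentLiftPair (hmd hW _)
  have hUW : (fun q ↦ mvfderiv (cotangentModel E) (momentum W) q (cotangentLiftPair nabla B Z 0 q))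
      = momentum (fun x ↦ nabla W x (Z x)) :=
    funext fun q ↦ by rw [mvfderiv_momentum_cotangentLiftPair (hmd hW _)]; simp
  have hBYW : MDiffAt (fun x ↦ B x (Y x) (W x)) p.proj :=
    (hB Y W hY hW _).mdifferentiableAt (by simp)
  have hBYW' : MDifferentiableAt (cotangentModel E) 𝓘(ℝ, ℝ)
      (fun q : CotangentBundle E M ↦ B q.proj (Y q.proj) (W q.proj)) p :=
    hBYW.comp p (mdifferentiableAt_cotangentProj p)
  rw [connector_apply nabla p _ (hmd hW _), hpr,
    mvfderiv_mlieBracket (contMDiff_momentum hW p) (hU p) (hV p)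
    (by rw [hUW]; exact mdifferentiableAt_momentum (hmd hZW _))
    (by rw [hVW]; exact hBYW'.add (mdifferentiableAt_momentum (hmd hXW _))),
    hVW, hUW, mvfderiv_fun_add hBYW' (mdifferentiableAt_momentum (hmd hXW _)), _root_.add_apply,
    mvfderiv_comp_proj hBYW, mvfderiv_momentum_cotangentLiftPair (hmd hXW _),
    mvfderiv_momentum_cotangentLiftPair (hmd hZW _),
    cotangentProj_cotangentLiftPair, hpar _ _ _ (hmd hY _) (hmd hW _)]
  have hf := congrArg p.2 (hflat Z X W hZ hX hW p.proj)
  simp only [map_sub, map_zero] at hf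
  simp only [momentum, Pi.zero_apply, map_zero, _root_.zero_apply]
  linarith

end Lift

/-! ### Lie derivatives of tensor fields -/

section LieDerivative

variable {E : Type*} [NormedAddCommGroup E] [NormedSpace ℝ E] [FiniteDimensional ℝ E]
  {H : Type*} [TopologicalSpace H] {I : ModelWithCorners ℝ E H}
  {M : Type*} [TopologicalSpace M] [ChartedSpace H M] [IsManifold I ∞ M]

/-- The Lie derivative `(L_Z B)(X, Y) = Z(B(X, Y)) - B([Z, X], Y) - B(X, [Z, Y])` of a two-tensor
field, as a function. -/
def lieDerivTensor (B : TwoTensor I M) (Z X Y : VField I M) (x : M) : ℝ :=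
  mvfderiv I (fun y ↦ B y (X y) (Y y)) x (Z x)
    - B x (mlieBracket I Z X x) (Y x) - B x (X x) (mlieBracket I Z Y x)

theorem lieDerivTensor_tensorial_left {B : TwoTensor I M} (hB : DiffTensor B) {x : M}
    {Z Y : VField I M} (hY : MDiffAt (T% Y) x) :
    TensorialAt I E (fun X ↦ lieDerivTensor B Z X Y x) x where
  smul {f X} hf hX := by
    have := FiniteDimensional.complete ℝ E
    unfold lieDerivTensor
    simp only [mvfderiv_tensor_smul_left hB hf hX hY]
    simp only [mlieBracket_smul_right hf hX, Pi.smul_apply', map_add, map_smul, smul_eq_mul,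
      _root_.add_apply, _root_.smul_apply]
    ring
  add {X X'} hX hX' := by
    have := FiniteDimensional.complete ℝ E
    unfold lieDerivTensor
    simp only [mvfderiv_tensor_add_left hB hX hX' hY]
    simp only [mlieBracket_add_right hX hX', Pi.add_apply, map_add, _root_.add_apply]
    ring

theorem lieDerivTensor_tensorial_right {B : TwoTensor I M} (hB : DiffTensor B) {x : M}
    {Z X : VField I M} (hX : MDiffAt (T% X) x) :
    TensorialAt I E (fun Y ↦ lieDerivTensor B Z X Y x) x where
  smul {f Y} hf hY := by
    have := FiniteDimensional.complete ℝ E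
    unfold lieDerivTensor
    simp only [mvfderiv_tensor_smul_right hB hf hX hY]
    simp only [mlieBracket_smul_right hf hY, Pi.smul_apply', map_add, map_smul, smul_eq_mul]
    ring
  add {Y Y'} hY hY' := by
    have := FiniteDimensional.complete ℝ E
    unfold lieDerivTensor
    simp only [mvfderiv_tensor_add_right hB hX hY hY']
    simp only [mlieBracket_add_right hY hY', Pi.add_apply, map_add]
    ring

/-- `(L_Z A) X` is tensorial in `X`. The hypothesis `hA` is the differentiability of `A` at `x`. -/
theorem lieDerivEnd_tensorial {A : EndField I M} {x : M} {Z : VField I M}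
    (hA : ∀ X : VField I M, MDiffAt (T% X) x → MDiffAt (T% (fun y ↦ A y (X y))) x) :
    TensorialAt I E (fun X ↦ lieDerivEnd Z A X x) x where
  smul {f X} hf hX := by
    have := FiniteDimensional.complete ℝ E
    have h1 : (fun y ↦ A y ((f • X) y)) = f • fun y ↦ A y (X y) := by
      ext y; simp
    simp only [lieDerivEnd]
    rw [h1, mlieBracket_smul_right hf (hA X hX), mlieBracket_smul_right hf hX]
    simp only [map_add, map_smul]
    module
  add {X X'} hX hX' := by
    have := FiniteDimensional.complete ℝ E
    have h1 : (fun y ↦ A y ((X + X') y)) = (fun y ↦ A y (X y)) + fun y ↦ A y (X' y) := by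
      ext y; simp
    simp only [lieDerivEnd]
    rw [h1, mlieBracket_add_right (hA X hX) (hA X' hX'), mlieBracket_add_right hX hX']
    simp only [map_add]
    abel

/-- For a Killing field `Z`, the Levi-Civita connection satisfies `2 B(D_Z Z, V) = -V(B(Z, Z))`. -/
theorem IsKilling.levi_civita_self {B : TwoTensor I M} {Z : VField I M} (hZ : IsKilling B Z)
    (hs : ∀ x v w, B x v w = B x w v) {D : AffineConnection I M} (hD : IsLeviCivita B D) (x : M)
    (v : TangentSpace I x) :
    2 * B x (D Z x (Z x)) v = -mvfderiv I (fun y ↦ B y (Z y) (Z y)) x v := by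
  obtain ⟨V, hV, rfl⟩ := exists_mdifferentiableAt_eq v
  have hZd : MDiffAt (T% Z) x := (hZ.1 x).mdifferentiableAt (by simp)
  have h1 := hZ.2 x Z V hZd hV
  rw [hD.2 x Z V hZd hV, ← hD.1.sub_eq hZd hV, mlieBracket_self] at h1
  rw [hD.2 x Z Z hZd hZd, hs x (D Z x (V x))]
  simp only [Pi.zero_apply, map_zero, _root_.zero_apply, map_sub] at h1
  linarith

end LieDerivative

/-! ### The metric and the complex structures of the rigid c-map -/

section Sums

variable {V V' ι κ : Type*} [Fintype ι] [Fintype κ] [AddCommGroup V] [Module ℝ V]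
  [TopologicalSpace V] [AddCommGroup V'] [Module ℝ V'] [TopologicalSpace V']

theorem ContinuousLinearMap.map_sum_smul (A : V →L[ℝ] V') (c : ι → ℝ) (v : ι → V) :
    A (∑ i, c i • v i) = ∑ i, c i • A (v i) := by
  simp

theorem ContinuousLinearMap.map_sum_smul₂ (B : V →L[ℝ] V →L[ℝ] ℝ) (c : ι → ℝ) (v : ι → V)
    (c' : κ → ℝ) (v' : κ → V) :
    B (∑ i, c i • v i) (∑ j, c' j • v' j) = ∑ i, ∑ j, c i * (c' j * B (v i) (v' j)) := by
  simp only [map_sum, map_smul, _root_.sum_apply, _root_.smul_apply, smul_eq_mul, Finset.mul_sum]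
  rw [Finset.sum_comm]
  exact Finset.sum_congr rfl fun i _ ↦ Finset.sum_congr rfl fun j _ ↦ by ring

end Sums

section CMap

variable {E : Type*} [NormedAddCommGroup E] [NormedSpace ℝ E]

section Form

variable {H : Type*} [TopologicalSpace H] {I : ModelWithCorners ℝ E H}
  {M : Type*} [TopologicalSpace M] [ChartedSpace H M] [IsManifold I ∞ M]
  {g : TwoTensor I M} {J : EndField I M}

theorem IsPseudoKahler.form_nondegenerate (hK : IsPseudoKahler g J) (x : M)
    (v : TangentSpace I x) (hv : ∀ w, fundamentalForm g J x v w = 0) : v = 0 := by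
  have h1 : J x v = 0 := hK.metric.nondegenerate x _ hv
  have h2 := hK.sq x v
  rw [h1, map_zero] at h2
  simpa using h2.symm

theorem IsPseudoKahler.smooth_form (hK : IsPseudoKahler g J) :
    IsSmoothTensor (fundamentalForm g J) := fun _ _ hX hY ↦
  TwoTensor.isSmoothTensor hK.metric.smooth _ _ (EndField.contMDiff_apply hK.smooth hX) hY

theorem IsPseudoKahler.form_comp_J (hK : IsPseudoKahler g J) {x : M} (b : TangentSpace I x) :
    fundamentalForm g J x b ∘L J x = -fundamentalForm g J x (J x b) := by
  ext w
  simp only [fundamentalForm, ContinuousLinearMap.comp_apply, _root_.neg_apply]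
  rw [hK.skew _ (J x b)]
  simp

end Form

variable {M : Type*} [TopologicalSpace M] [ChartedSpace E M] [IsManifold 𝓘(ℝ, E) ∞ M]
  [FiniteDimensional ℝ E]
  {g : TwoTensor 𝓘(ℝ, E) M} {J : EndField 𝓘(ℝ, E) M} {nabla : AffineConnection 𝓘(ℝ, E) M}

theorem cmapMetric_apply (p : CotangentBundle E M) (u v : TangentSpace (cotangentModel E) p) :
    cmapMetric g nabla p u v = g p.proj (cotangentProj p u) (cotangentProj p v)
      + connector nabla p v (inverseTensor g p.proj (connector nabla p u)) := rfl

/-- With vertical parts written as `ω b`, the metric `g ⊕ g⁻¹` becomes `g ⊕ g`, because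
`g⁻¹ ∘ ω = J` is an isometry. -/
theorem cmapMetric_splitting_symm (hK : IsPseudoKahler g J) (p : CotangentBundle E M)
    (a b a' b' : TangentSpace 𝓘(ℝ, E) p.proj) :
    cmapMetric g nabla p ((splitting nabla p).symm (a, fundamentalForm g J p.proj b))
      ((splitting nabla p).symm (a', fundamentalForm g J p.proj b')) =
        g p.proj a a' + g p.proj b b' := by
  simp only [cmapMetric_apply, cotangentProj_splitting_symm, connector_splitting_symm,
    fundamentalForm, ContinuousLinearMap.comp_apply]
  rw [(inverseTensor_spec g p.proj (hK.metric.nondegenerate _)).1, hK.skew, hK.sq,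
    hK.metric.symm _ b b']
  simp

theorem cmapJ₁_splitting_symm (p : CotangentBundle E M)
    (z : TangentSpace 𝓘(ℝ, E) p.proj × (TangentSpace 𝓘(ℝ, E) p.proj →L[ℝ] ℝ)) :
    cmapJ₁ J nabla p ((splitting nabla p).symm z) =
      (splitting nabla p).symm (J p.proj z.1, z.2 ∘L J p.proj) := by
  simp [cmapJ₁]
  rfl

theorem cmapJ₂_splitting_symm (hK : IsPseudoKahler g J) (p : CotangentBundle E M)
    (a b : TangentSpace 𝓘(ℝ, E) p.proj) :
    cmapJ₂ g J nabla p ((splitting nabla p).symm (a, fundamentalForm g J p.proj b)) =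
      (splitting nabla p).symm (-b, fundamentalForm g J p.proj a) := by
  simp [cmapJ₂, (inverseTensor_spec _ p.proj (hK.form_nondegenerate p.proj)).1]

theorem exists_splitting_symm_eq (hK : IsPseudoKahler g J) {p : CotangentBundle E M}
    (u : TangentSpace (cotangentModel E) p) :
    ∃ a b : TangentSpace 𝓘(ℝ, E) p.proj,
      u = (splitting nabla p).symm (a, fundamentalForm g J p.proj b) := by
  refine ⟨cotangentProj p u,
    inverseTensor (fundamentalForm g J) p.proj (connector nabla p u), ?_⟩
  rw [(inverseTensor_spec _ p.proj (hK.form_nondegenerate p.proj)).2]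
  exact ((splitting nabla p).symm_apply_apply u).symm

theorem cmapMetric_symm (hK : IsPseudoKahler g J) (p : CotangentBundle E M)
    (u v : TangentSpace (cotangentModel E) p) :
    cmapMetric g nabla p u v = cmapMetric g nabla p v u := by
  obtain ⟨a, b, rfl⟩ := exists_splitting_symm_eq (nabla := nabla) hK u
  obtain ⟨a', b', rfl⟩ := exists_splitting_symm_eq (nabla := nabla) hK v
  rw [cmapMetric_splitting_symm hK, cmapMetric_splitting_symm hK, hK.metric.symm _ a,
    hK.metric.symm _ b]

theorem cmapMetric_nondegenerate (hK : IsPseudoKahler g J) (p : CotangentBundle E M)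
    (u : TangentSpace (cotangentModel E) p) (hu : ∀ v, cmapMetric g nabla p u v = 0) : u = 0 := by
  obtain ⟨a, b, rfl⟩ := exists_splitting_symm_eq (nabla := nabla) hK u
  have ha : a = 0 := hK.metric.nondegenerate _ _ fun w ↦ by
    have := hu ((splitting nabla p).symm (w, fundamentalForm g J p.proj 0))
    rw [cmapMetric_splitting_symm hK] at this
    simpa using this
  have hb : b = 0 := hK.metric.nondegenerate _ _ fun w ↦ by
    have := hu ((splitting nabla p).symm (0, fundamentalForm g J p.proj w))
    rw [cmapMetric_splitting_symm hK] at this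
    simpa using this
  rw [ha, hb, map_zero]
  exact map_zero _

variable [T2Space M]

/-- A vector field on `T*M` is near each point where it is differentiable a combination of lifts of
pairs of smooth vector fields on `M`, since horizontal lifts and vertical lifts of a basis of `T_xM`
form a basis of the tangent space of `T*M`. -/
theorem exists_cotangent_frame (hK : IsPseudoKahler g J)
    (hn : CovariantDerivative.ContMDiffCovariantDerivative nabla ∞)
    {U : VField (cotangentModel E) (CotangentBundle E M)} {p : CotangentBundle E M}
    (hU : MDifferentiableAt (cotangentModel E) (cotangentModel E).tangent (T% U) p) :
    ∃ (n : ℕ) (X Y : Fin n ⊕ Fin n → VField 𝓘(ℝ, E) M)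
      (c : Fin n ⊕ Fin n → CotangentBundle E M → ℝ),
      (∀ i, ContMDiff 𝓘(ℝ, E) 𝓘(ℝ, E).tangent ∞ (T% (X i))) ∧
      (∀ i, ContMDiff 𝓘(ℝ, E) 𝓘(ℝ, E).tangent ∞ (T% (Y i))) ∧
      (∀ i, MDifferentiableAt (cotangentModel E) 𝓘(ℝ, ℝ) (c i) p) ∧
      ∀ᶠ q in 𝓝 p, U q = ∑ i, c i q •
        cotangentLiftPair nabla (fundamentalForm g J) (X i) (Y i) q := by
  let b := Module.finBasis ℝ (TangentSpace 𝓘(ℝ, E) p.proj)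
  choose W hW hWb using fun i ↦ exists_contMDiff_eq (I := 𝓘(ℝ, E)) (b i)
  have h0 : ContMDiff 𝓘(ℝ, E) 𝓘(ℝ, E).tangent ∞ (T% (0 : VField 𝓘(ℝ, E) M)) :=
    contMDiff_zeroSection ℝ _
  let X : Fin (Module.finrank ℝ (TangentSpace 𝓘(ℝ, E) p.proj)) ⊕
      Fin (Module.finrank ℝ (TangentSpace 𝓘(ℝ, E) p.proj)) → VField 𝓘(ℝ, E) M :=
    Sum.elim W fun _ ↦ 0
  let Y : Fin (Module.finrank ℝ (TangentSpace 𝓘(ℝ, E) p.proj)) ⊕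
      Fin (Module.finrank ℝ (TangentSpace 𝓘(ℝ, E) p.proj)) → VField 𝓘(ℝ, E) M :=
    Sum.elim (fun _ ↦ 0) W
  have hX : ∀ i, ContMDiff 𝓘(ℝ, E) 𝓘(ℝ, E).tangent ∞ (T% (X i)) := by
    rintro (i | i)
    exacts [hW i, h0]
  have hY : ∀ i, ContMDiff 𝓘(ℝ, E) 𝓘(ℝ, E).tangent ∞ (T% (Y i)) := by
    rintro (i | i)
    exacts [h0, hW i]
  let Φ : TangentSpace 𝓘(ℝ, E) p.proj × TangentSpace 𝓘(ℝ, E) p.proj →ₗ[ℝ]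
      TangentSpace (cotangentModel E) p :=
    (splitting nabla p).symm.toLinearMap ∘ₗ
      (LinearMap.id.prodMap (fundamentalForm g J p.proj).toLinearMap)
  have hΦ : LinearMap.ker Φ = ⊥ := by
    rw [LinearMap.ker_eq_bot']
    intro z hz
    have h1 := (map_eq_zero_iff _ (splitting nabla p).symm.injective).mp hz
    refine Prod.ext congr(($h1).1) (hK.form_nondegenerate _ _ fun w ↦ ?_)
    exact congr(($h1).2 w)
  have hli : LinearIndependent ℝ
      (fun i ↦ cotangentLiftPair nabla (fundamentalForm g J) (X i) (Y i) p) := by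
    have h1 := (b.prod b).linearIndependent.map' Φ hΦ
    have h2 : (fun i ↦ cotangentLiftPair nabla (fundamentalForm g J) (X i) (Y i) p) =
        Φ ∘ b.prod b := by
      ext1 i
      rcases i with i | i <;> simp [X, Y, Φ, cotangentLiftPair, hWb]
    rw [h2]
    exact h1
  have hcard : Fintype.card (Fin (Module.finrank ℝ (TangentSpace 𝓘(ℝ, E) p.proj)) ⊕
      Fin (Module.finrank ℝ (TangentSpace 𝓘(ℝ, E) p.proj))) =
      Module.finrank ℝ (E × (E →L[ℝ] ℝ)) := by
    have h1 : Module.finrank ℝ (E →L[ℝ] ℝ) = Module.finrank ℝ E := by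
      rw [← LinearEquiv.finrank_eq (LinearMap.toContinuousLinearMap
        (𝕜 := ℝ) (E := E) (F' := ℝ)), Subspace.dual_finrank_eq]
    rw [Fintype.card_sum, Fintype.card_fin, Module.finrank_prod, h1]
    rfl
  obtain ⟨c, hc, hUc⟩ := mdifferentiableAt_frame_coeff (fun i ↦
    (contMDiff_cotangentLiftPair hn hK.smooth_form (hX i) (hY i) p).mdifferentiableAt (by simp))
    hli hcard hU
  exact ⟨_, X, Y, c, hX, hY, hc, hUc⟩

/-- `J₂` preserves differentiability: on lifts of pairs it is `(X, Y) ↦ (-Y, X)`. -/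
theorem mdifferentiableAt_cmapJ₂ (hK : IsPseudoKahler g J)
    (hn : CovariantDerivative.ContMDiffCovariantDerivative nabla ∞)
    {U : VField (cotangentModel E) (CotangentBundle E M)} {p : CotangentBundle E M}
    (hU : MDifferentiableAt (cotangentModel E) (cotangentModel E).tangent (T% U) p) :
    MDifferentiableAt (cotangentModel E) (cotangentModel E).tangent
      (T% (fun q ↦ cmapJ₂ g J nabla q (U q))) p := by
  obtain ⟨n, X, Y, c, hX, hY, hc, h⟩ := exists_cotangent_frame (nabla := nabla) hK hn hU
  have h1 : MDifferentiableAt (cotangentModel E) (cotangentModel E).tangent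
      (T% (fun q ↦ ∑ i, c i q • cotangentLiftPair nabla (fundamentalForm g J) (-Y i) (X i) q)) p :=
    MDifferentiableAt.sum_section fun i _ ↦ (hc i).smul_section
      ((contMDiff_cotangentLiftPair hn hK.smooth_form (hY i).neg_section (hX i)
        p).mdifferentiableAt (by simp))
  refine h1.congr_of_eventuallyEq ?_
  filter_upwards [h] with q hq
  rw [hq]
  refine congrArg (TotalSpace.mk' _ q) ((ContinuousLinearMap.map_sum_smul _ _ _).trans ?_)
  refine Finset.sum_congr rfl fun i _ ↦ congrArg (c i q • ·) ?_
  exact cmapJ₂_splitting_symm hK q _ _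

theorem diffTensor_cmapMetric (hK : IsPseudoKahler g J)
    (hn : CovariantDerivative.ContMDiffCovariantDerivative nabla ∞) :
    DiffTensor (cmapMetric g nabla) := by
  intro p U V hU hV
  obtain ⟨n, X, Y, c, hX, hY, hc, h⟩ := exists_cotangent_frame (nabla := nabla) hK hn hU
  obtain ⟨n', X', Y', c', hX', hY', hc', h'⟩ := exists_cotangent_frame (nabla := nabla) hK hn hV
  have hmd : ∀ {A : VField 𝓘(ℝ, E) M}, ContMDiff 𝓘(ℝ, E) 𝓘(ℝ, E).tangent ∞ (T% A) →
      ∀ x, MDiffAt (T% A) x := fun hA x ↦ (hA x).mdifferentiableAt (by simp)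
  have h1 : MDifferentiableAt (cotangentModel E) 𝓘(ℝ, ℝ)
      (∑ i, ∑ j, fun q : CotangentBundle E M ↦ c i q * (c' j q *
        (g q.proj (X i q.proj) (X' j q.proj) + g q.proj (Y i q.proj) (Y' j q.proj)))) p := by
    refine MDifferentiableAt.sum fun i _ ↦ MDifferentiableAt.sum fun j _ ↦
      (hc i).mul ((hc' j).mul ?_)
    have hg := TwoTensor.diffTensor hK.metric.smooth
    exact MDifferentiableAt.comp (g := fun x ↦ g x (X i x) (X' j x) + g x (Y i x) (Y' j x)) p
      ((hg _ _ _ (hmd (hX i) _) (hmd (hX' j) _)).add (hg _ _ _ (hmd (hY i) _) (hmd (hY' j) _)))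
      (mdifferentiableAt_cotangentProj p)
  refine h1.congr_of_eventuallyEq ?_
  filter_upwards [h, h'] with q hq hq'
  rw [hq, hq']
  refine (ContinuousLinearMap.map_sum_smul₂ _ _ _ _ _).trans ?_
  simp only [Finset.sum_apply]
  refine Finset.sum_congr rfl fun i _ ↦ Finset.sum_congr rfl fun j _ ↦ ?_
  exact congrArg (fun t ↦ c i q * (c' j q * t)) (cmapMetric_splitting_symm hK q _ _ _ _)

end CMap

/-! ### The canonical extension in affine coordinates -/

section AffineCoordinates

variable {E : Type*} [NormedAddCommGroup E] [NormedSpace ℝ E] [FiniteDimensional ℝ E]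
  {M : Type*} [TopologicalSpace M] [ChartedSpace E M] [IsManifold 𝓘(ℝ, E) ∞ M]

theorem mdifferentiableAt_coordField {φ : OpenPartialHomeomorph M E}
    (hφ : φ ∈ IsManifold.maximalAtlas 𝓘(ℝ, E) ∞ M) (e : E) {x : M} (hx : x ∈ φ.source) :
    MDiffAt (T% (coordField φ e)) x := by
  have := FiniteDimensional.complete ℝ E
  have h1 : φ.MDifferentiable 𝓘(ℝ, E) 𝓘(ℝ, E) :=
    ⟨(contMDiffOn_of_mem_maximalAtlas hφ).mdifferentiableOn (by simp),
      (contMDiffOn_symm_of_mem_maximalAtlas hφ).mdifferentiableOn (by simp)⟩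
  have h2 : MDiffAt (fun y : E ↦ (⟨y, e⟩ : TangentBundle 𝓘(ℝ, E) E)) (φ x) :=
    ((contMDiffAt_vectorSpace_iff_contDiffAt (V := fun _ ↦ e) (n := 1)).mpr
      contDiffAt_const).mdifferentiableAt one_ne_zero
  refine MDifferentiableAt.mpullback_vectorField (n := ∞) h2
    (contMDiffAt_of_mem_maximalAtlas hφ hx) ⟨h1.mfderiv hx, rfl⟩ ?_
  exact WithTop.coe_le_coe.mpr le_top

theorem isAffineCoordinateLift_cotangentLift (nabla : AffineConnection 𝓘(ℝ, E) M)
    (Z : VField 𝓘(ℝ, E) M) : IsAffineCoordinateLift nabla Z (cotangentLift nabla Z) := by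
  intro φ hφ p hp
  refine ⟨fun l ↦ ?_, fun e ↦ ?_⟩
  · have hl : MDiffAt (fun x ↦ l (φ x)) p.proj :=
      l.mdifferentiableAt.comp p.proj
        ((contMDiffAt_of_mem_maximalAtlas hφ.1 hp).mdifferentiableAt (by simp))
    rw [mvfderiv_comp_proj hl, cotangentLift, cotangentProj_splitting_symm]
  · rw [mvfderiv_momentum nabla p _ (mdifferentiableAt_coordField hφ.1 e hp), hφ.2 e _ hp,
      cotangentLift, connector_splitting_symm]
    simp

end AffineCoordinates

/-! ### The rotating Killing field of the rigid c-map -/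

section CMapLift

variable {E : Type*} [NormedAddCommGroup E] [NormedSpace ℝ E] [FiniteDimensional ℝ E]
  {M : Type*} [TopologicalSpace M] [ChartedSpace E M] [IsManifold 𝓘(ℝ, E) ∞ M]
  {g : TwoTensor 𝓘(ℝ, E) M} {J : EndField 𝓘(ℝ, E) M} {nabla : AffineConnection 𝓘(ℝ, E) M}

theorem cmapMetric_cotangentLift
    (p : CotangentBundle E M) (v : TangentSpace (cotangentModel E) p) (Z : VField 𝓘(ℝ, E) M) :
    cmapMetric g nabla p (cotangentLift nabla Z p) v = g p.proj (Z p.proj) (cotangentProj p v) := by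
  rw [cmapMetric_apply, cotangentLift, cotangentProj_splitting_symm, connector_splitting_symm]
  simp

theorem cmapJ₁_cotangentLift (p : CotangentBundle E M) (Z : VField 𝓘(ℝ, E) M) :
    cmapJ₁ J nabla p (cotangentLift nabla Z p) =
      cotangentLift nabla (fun x ↦ J x (Z x)) p := by
  rw [cotangentLift, cmapJ₁_splitting_symm, ContinuousLinearMap.zero_comp]
  rfl

end CMapLift

namespace IsConicalSpecialKahler

variable {E : Type*} [NormedAddCommGroup E] [NormedSpace ℝ E] [FiniteDimensional ℝ E]
  {M : Type*} [TopologicalSpace M] [ChartedSpace E M] [IsManifold 𝓘(ℝ, E) ∞ M]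
  {g : TwoTensor 𝓘(ℝ, E) M} {J : EndField 𝓘(ℝ, E) M} {nabla : AffineConnection 𝓘(ℝ, E) M}
  {ξ : VField 𝓘(ℝ, E) M}

/-- The Hamiltonian is the pullback of `g(ξ, ξ) / 2`, because `J₁ Z_N` is the horizontal lift of
`JZ = -ξ`. -/
theorem isHamiltonian_cotangentLift (hM : IsConicalSpecialKahler g J nabla ξ) :
    IsHamiltonian (fundamentalForm (cmapMetric g nabla) (cmapJ₁ J nabla))
      (cotangentLift nabla (fun x ↦ J x (ξ x))) := by
  have hs : ContMDiff 𝓘(ℝ, E) 𝓘(ℝ, ℝ) ∞ (fun x ↦ (1 / 2 : ℝ) * g x (ξ x) (ξ x)) :=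
    contMDiff_const.mul (TwoTensor.isSmoothTensor hM.kahler.metric.smooth ξ ξ hM.smooth_xi
      hM.smooth_xi)
  refine ⟨fun p ↦ (1 / 2 : ℝ) * g p.proj (ξ p.proj) (ξ p.proj),
    hs.comp (contMDiff_proj (fun x : M ↦ TangentSpace 𝓘(ℝ, E) x →L[ℝ] ℝ)), fun p v ↦ ?_⟩
  have h1 := (hM.diffTensor p.proj ξ ξ hM.mdiff_xi hM.mdiff_xi)
  rw [mvfderiv_comp_proj (f := fun x ↦ (1 / 2 : ℝ) * g x (ξ x) (ξ x))
    ((hs p.proj).mdifferentiableAt (by simp)), mvfderiv_fun_mul mdifferentiableAt_const h1,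
    fundamentalForm, ContinuousLinearMap.comp_apply, cmapJ₁_cotangentLift,
    cmapMetric_cotangentLift, hM.kahler.sq]
  simp [hM.mvfderiv_metric_xi_xi, mvfderiv_const]

/-- Since `Z_N` is a Killing field, `D_{Z_N} Z_N` is minus half the gradient of
`g_N(Z_N, Z_N) = π*(g(ξ, ξ))`, that is, the horizontal lift of `-ξ`. -/
theorem levi_civita_cotangentLift (hM : IsConicalSpecialKahler g J nabla ξ)
    (hk : IsKilling (cmapMetric g nabla) (cotangentLift nabla (fun x ↦ J x (ξ x))))
    {D : AffineConnection (cotangentModel E) (CotangentBundle E M)}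
    (hD : IsLeviCivita (cmapMetric g nabla) D) (p : CotangentBundle E M) :
    D (cotangentLift nabla (fun x ↦ J x (ξ x))) p (cotangentLift nabla (fun x ↦ J x (ξ x)) p) =
      cmapJ₁ J nabla p (cotangentLift nabla (fun x ↦ J x (ξ x)) p) := by
  rw [← sub_eq_zero]
  refine cmapMetric_nondegenerate (nabla := nabla) hM.kahler p _ fun v ↦ ?_
  have h1 := hk.levi_civita_self (cmapMetric_symm hM.kahler) hD p v
  have h2 : (fun q ↦ cmapMetric g nabla q (cotangentLift nabla (fun x ↦ J x (ξ x)) q)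
      (cotangentLift nabla (fun x ↦ J x (ξ x)) q)) =
      fun q : CotangentBundle E M ↦ g q.proj (ξ q.proj) (ξ q.proj) := by
    funext q
    rw [cmapMetric_cotangentLift, cotangentLift, cotangentProj_splitting_symm, hM.metric_J_J]
  rw [h2, mvfderiv_comp_proj (f := fun x ↦ g x (ξ x) (ξ x))
    (hM.diffTensor p.proj ξ ξ hM.mdiff_xi hM.mdiff_xi), hM.mvfderiv_metric_xi_xi] at h1
  refine (ContinuousLinearMap.map_sub₂ _ _ _ _).trans ?_
  rw [cmapJ₁_cotangentLift, cmapMetric_cotangentLift, hM.kahler.sq]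
  have h3 := ContinuousLinearMap.map_neg₂ (g p.proj) (ξ p.proj) (cotangentProj p v)
  linarith

variable [T2Space M]

/-- On lifts of pairs `(X, Y)` the field `Z_N` acts by `(L_Z, ∇_Z)` and `g_N` is `g ⊕ g`, so the
Killing equation reduces to `L_Z g = 0` and `∇_Z g = 0` on `M`. -/
theorem isKilling_cotangentLift (hM : IsConicalSpecialKahler g J nabla ξ) :
    IsKilling (cmapMetric g nabla) (cotangentLift nabla (fun x ↦ J x (ξ x))) := by
  have hK := hM.kahler
  have hω := hK.smooth_form
  have hn := hM.smooth_nabla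
  have hZ := EndField.contMDiff_apply hK.smooth hM.smooth_xi
  have hmd : ∀ {A : VField 𝓘(ℝ, E) M}, ContMDiff 𝓘(ℝ, E) 𝓘(ℝ, E).tangent ∞ (T% A) →
      ∀ x, MDiffAt (T% A) x := fun hA x ↦ (hA x).mdifferentiableAt (by simp)
  constructor
  · rw [cotangentLift_eq_cotangentLiftPair (B := fundamentalForm g J)]
    exact contMDiff_cotangentLiftPair hn hω hZ (contMDiff_zeroSection ℝ _)
  intro p U V hU hV
  have hd := diffTensor_cmapMetric hK hn
  obtain ⟨a, b, hab⟩ := exists_splitting_symm_eq (nabla := nabla) hK (U p)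
  obtain ⟨a', b', hab'⟩ := exists_splitting_symm_eq (nabla := nabla) hK (V p)
  obtain ⟨X, hX, rfl⟩ := exists_contMDiff_eq (I := 𝓘(ℝ, E)) a
  obtain ⟨Y, hY, rfl⟩ := exists_contMDiff_eq (I := 𝓘(ℝ, E)) b
  obtain ⟨X', hX', rfl⟩ := exists_contMDiff_eq (I := 𝓘(ℝ, E)) a'
  obtain ⟨Y', hY', rfl⟩ := exists_contMDiff_eq (I := 𝓘(ℝ, E)) b'
  have hL := (contMDiff_cotangentLiftPair hn hω hX hY p).mdifferentiableAt (by simp)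
  have hL' := (contMDiff_cotangentLiftPair hn hω hX' hY' p).mdifferentiableAt (by simp)
  refine (TensorialAt.pointwise₂
    (fun _ h ↦ lieDerivTensor_tensorial_left hd (Z := cotangentLift nabla (fun x ↦ J x (ξ x))) h)
    (fun _ h ↦ lieDerivTensor_tensorial_right hd h) hU hL hV hL' hab hab').trans ?_
  have h1 := hM.diffTensor p.proj X X' (hmd hX _) (hmd hX' _)
  have h2 := hM.diffTensor p.proj Y Y' (hmd hY _) (hmd hY' _)
  have h3 : (fun q ↦ cmapMetric g nabla q (cotangentLiftPair nabla (fundamentalForm g J) X Y q)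
      (cotangentLiftPair nabla (fundamentalForm g J) X' Y' q)) =
      fun q : CotangentBundle E M ↦ g q.proj (X q.proj) (X' q.proj)
        + g q.proj (Y q.proj) (Y' q.proj) :=
    funext fun q ↦ cmapMetric_splitting_symm hK q _ _ _ _
  rw [lieDerivTensor, h3, mlieBracket_cotangentLiftPair hn hM.flat hM.parallel_form hω hZ hX hY,
    mlieBracket_cotangentLiftPair hn hM.flat hM.parallel_form hω hZ hX' hY',
    mvfderiv_comp_proj (f := fun x ↦ g x (X x) (X' x) + g x (Y x) (Y' x)) (h1.add h2),
    mvfderiv_fun_add h1 h2, _root_.add_apply]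
  simp only [cotangentLiftPair, cmapMetric_splitting_symm hK, cotangentLift,
    cotangentProj_splitting_symm]
  rw [hM.mvfderiv_metric_J_xi (hmd hX _) (hmd hX' _),
    hM.mvfderiv_metric_nabla_J_xi (hmd hY _) (hmd hY' _)]
  ring

/-- On lifts of pairs `J₂(X, Y) = (-Y, X)`, while `Z_N` acts by `(L_Z, ∇_Z)` and `∇_Z - L_Z = J`,
which gives `(L_{Z_N} J₂)(X, Y) = (JY, JX)`. -/
theorem lieDerivEnd_cotangentLift (hM : IsConicalSpecialKahler g J nabla ξ)
    {p : CotangentBundle E M} {U : VField (cotangentModel E) (CotangentBundle E M)}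
    (hU : MDifferentiableAt (cotangentModel E) (cotangentModel E).tangent (T% U) p) :
    lieDerivEnd (cotangentLift nabla (fun x ↦ J x (ξ x))) (cmapJ₂ g J nabla) U p =
      -cmapJ₃ g J nabla p (U p) := by
  have hK := hM.kahler
  have hω := hK.smooth_form
  have hn := hM.smooth_nabla
  have hZ := EndField.contMDiff_apply hK.smooth hM.smooth_xi
  have hmd : ∀ {A : VField 𝓘(ℝ, E) M}, ContMDiff 𝓘(ℝ, E) 𝓘(ℝ, E).tangent ∞ (T% A) →
      ∀ x, MDiffAt (T% A) x := fun hA x ↦ (hA x).mdifferentiableAt (by simp)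
  obtain ⟨a, b, hab⟩ := exists_splitting_symm_eq (nabla := nabla) hK (U p)
  obtain ⟨X, hX, rfl⟩ := exists_contMDiff_eq (I := 𝓘(ℝ, E)) a
  obtain ⟨Y, hY, rfl⟩ := exists_contMDiff_eq (I := 𝓘(ℝ, E)) b
  have hL := (contMDiff_cotangentLiftPair hn hω hX hY p).mdifferentiableAt (by simp)
  have hY' : ContMDiff 𝓘(ℝ, E) 𝓘(ℝ, E).tangent ∞ (T% (-Y)) := hY.neg_section
  refine ((lieDerivEnd_tensorial fun _ h ↦ mdifferentiableAt_cmapJ₂ hK hn h).pointwise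
    hU hL hab).trans ?_
  have h3 : (fun q ↦ cmapJ₂ g J nabla q (cotangentLiftPair nabla (fundamentalForm g J) X Y q)) =
      cotangentLiftPair nabla (fundamentalForm g J) (-Y) X :=
    funext fun q ↦ cmapJ₂_splitting_symm hK q _ _
  have h4 : mlieBracket 𝓘(ℝ, E) (fun x ↦ J x (ξ x)) (-Y) p.proj =
      -mlieBracket 𝓘(ℝ, E) (fun x ↦ J x (ξ x)) Y p.proj := by
    have := FiniteDimensional.complete ℝ E
    simpa using mlieBracket_const_smul_right (c := (-1 : ℝ))
      (V := fun x ↦ J x (ξ x)) (hmd hY p.proj)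
  rw [lieDerivEnd, h3, mlieBracket_cotangentLiftPair hn hM.flat hM.parallel_form hω hZ hX hY,
    mlieBracket_cotangentLiftPair hn hM.flat hM.parallel_form hω hZ hY' hX, hab,
    cmapJ₃, ContinuousLinearMap.comp_apply, cmapJ₂_splitting_symm hK, cmapJ₁_splitting_symm]
  refine (congrArg _ (cmapJ₂_splitting_symm hK p _ _)).trans ?_
  refine ((map_sub (splitting nabla p).symm _ _).symm.trans ?_).trans
    (map_neg (splitting nabla p).symm _)
  congr 1
  refine Prod.ext ?_ ?_
  · simp [h4, hM.nabla_apply_J_xi (hmd hY _)]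
  · simp [hM.nabla_apply_J_xi (hmd hX _), hK.form_comp_J]

end IsConicalSpecialKahler

end

theorem mainTheorem5 {E : Type*} [NormedAddCommGroup E] [NormedSpace ℝ E] [FiniteDimensional ℝ E]
    {M : Type*} [TopologicalSpace M] [T2Space M] [ChartedSpace E M] [IsManifold 𝓘(ℝ, E) ∞ M]
    (g : TwoTensor 𝓘(ℝ, E) M) (J : EndField 𝓘(ℝ, E) M) (nabla : AffineConnection 𝓘(ℝ, E) M)
    (ξ : VField 𝓘(ℝ, E) M) (hM : IsConicalSpecialKahler g J nabla ξ)
    (Z : VField 𝓘(ℝ, E) M) (hZ : Z = fun x ↦ J x (ξ x))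
    (gN : TwoTensor (cotangentModel E) (CotangentBundle E M)) (hgN : gN = cmapMetric g nabla)
    (J₁ J₂ J₃ : EndField (cotangentModel E) (CotangentBundle E M))
    (hJ₁ : J₁ = cmapJ₁ J nabla) (hJ₂ : J₂ = cmapJ₂ g J nabla) (hJ₃ : J₃ = cmapJ₃ g J nabla)
    (ZN : VField (cotangentModel E) (CotangentBundle E M)) (hZN : ZN = cotangentLift nabla Z) :
    IsAffineCoordinateLift nabla Z ZN ∧
    (∀ p : CotangentBundle E M, gN p (ZN p) (ZN p) ≠ 0) ∧
    IsKilling gN ZN ∧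
    IsHamiltonian (fundamentalForm gN J₁) ZN ∧
    (∃ D : AffineConnection (cotangentModel E) (CotangentBundle E M), IsLeviCivita gN D) ∧
    (∀ D : AffineConnection (cotangentModel E) (CotangentBundle E M), IsLeviCivita gN D →
      ∀ p : CotangentBundle E M, D ZN p (ZN p) = J₁ p (ZN p)) ∧
    (∀ (p : CotangentBundle E M) (X : VField (cotangentModel E) (CotangentBundle E M)),
      MDifferentiableAt (cotangentModel E) (cotangentModel E).tangent (T% X) p →
        lieDerivEnd ZN J₂ X p = -J₃ p (X p)) := by
  subst hZ hgN hJ₁ hJ₂ hJ₃ hZN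
  refine ⟨isAffineCoordinateLift_cotangentLift nabla _, fun p ↦ ?_, hM.isKilling_cotangentLift,
    hM.isHamiltonian_cotangentLift, ?_, fun D hD p ↦ ?_, fun p U hU ↦ ?_⟩
  · rw [cmapMetric_cotangentLift, cotangentLift, cotangentProj_splitting_symm]
    exact hM.metric_J_xi_ne_zero p.proj
  · exact exists_isLeviCivita (diffTensor_cmapMetric hM.kahler hM.smooth_nabla)
      (cmapMetric_symm hM.kahler) (cmapMetric_nondegenerate hM.kahler)
  · exact hM.levi_civita_cotangentLift hM.isKilling_cotangentLift hD p
  · exact hM.lieDerivEnd_cotangentLift hU
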